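/- Let $J^1(\mathbb{R}^2)$ be the three-dimensional manifold of all pairs $(p,l)$ of a point $p\in\mathbb{R}^2$ and a one-dimensional subspace $l\subset T_p\mathbb{R}^2$, with projection $\pi(p,l)=p$, vertical direction field $V_q=\ker d_q\pi$ and contact distribution $C_q=\{\xi : d_q\pi(\xi)\in l\}$ at $q=(p,l)$. A second-order equation in the plane (solved for the highest derivative) near $q\in J^1(\mathbb{R}^2)$ is a smooth direction field $E$ near $q$ with $E\subset C$ and $E\neq V$ at every point; in the chart $(x,y,z=dy/dx)$ the equation $y''=F(x,y,y')$ is the field spanned by $\partial_x+z\,\partial_y+F(x,y,z)\,\partial_z$. Equations $E$ near $q$ and $E'$ near $q'$ are locally equivalent (under point transformations) if there is a local diffeomorphism $\varphi$ of the plane, defined near $\pi(q)$, whose prolongation $\varphi^{(1)}(p,l)=(\varphi(p),d_p\varphi(l))$ takes $q$ to $q'$ and, near $q$, takes $E$ to $E'$. A nondegenerate pair of direction fields near a point $p\in\mathbb{R}^3$ is a pair of smooth direction fields $E_1,E_2$ near $p$ with $E_1(p)\ne E_2(p)$ whose sum $E_1\oplus E_2$ is not integrable at $p$: for generators $X_1,X_2$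 of $E_1,E_2$ near $p$, $[X_1,X_2](p)\notin E_1(p)\oplus E_2(p)$. Pairs $(E_1,E_2)$ near $p$ and $(E_1',E_2')$ near $p'$ are locally equivalent if some local diffeomorphism of $\mathbb{R}^3$ takes $p$ to $p'$ and, near $p$, takes $E_1$ to $E_1'$ and $E_2$ to $E_2'$. The equation $E$ near $q$ corresponds to the pair $(E_1,E_2)$ near $p$ if there is a local diffeomorphism $\Phi$ from a neighbourhood of $p$ in $\mathbb{R}^3$ to a neighbourhood of $q$ in $J^1(\mathbb{R}^2)$ with $\Phi(p)=q$, $d\Phi(E_1\oplus E_2)=C$, $d\Phi(E_1)=V$ and $d\Phi(E_2)=E$. Theorem 2. Let $(E_1,E_2)$ near $p$ and $(E_1',E_2')$ near $p'$ be nondegenerate pairs of direction fields in $\mathbb{R}^3$. Each of them has a corresponding field on $J^1(\mathbb{R}^2)$, and every such field is a second-order equation in the plane. If $E$ near $q$ corresponds to $(E_1,E_2)$ near $p$, and $E'$ near $q'$ to $(E_1',E_2')$ near $p'$, then the pairs $(E_1,E_2)$ and $(E_1',E_2')$ are locally equivalent (at $p$, $p'$) if and only if the equations $E$ and $E'$ are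 locally equivalent (at $q$, $q'$). -/

import Mathlib

open scoped Manifold ContDiff Topology LinearAlgebra.Projectivization

-- Otherwise instance search on an abbreviation of a normed space finds this instance, applied
-- several times to the standard charted space structure, instead of the standard one itself.
attribute [-instance] TopCat.of.chartedSpace

/-! ## The space of first jets of the plane -/

/-- The plane `ℝ²`, with coordinates `(x, y)`. -/
abbrev Plane : Type := ℝ × ℝ

/-- The three-dimensional space `ℝ³`. -/
abbrev Space : Type := ℝ × ℝ × ℝ

/-- The set of directions (one-dimensional linear subspaces) of `ℝ²`. -/
abbrev PlaneDirection : Type := ℙ ℝ Plane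

namespace PlaneDirection

/-- The direction of the vector `(1, z)`. -/
noncomputable def ofSlope (z : ℝ) : PlaneDirection :=
  Projectivization.mk ℝ ((1, z) : Plane) (by simp)

/-- The direction of the vector `(z, 1)`. -/
noncomputable def ofCoslope (z : ℝ) : PlaneDirection :=
  Projectivization.mk ℝ ((z, 1) : Plane) (by simp)

/-- The coordinate `β / α` of the direction of `(α, β)`, meaningful for `α ≠ 0`. -/
noncomputable def slope : PlaneDirection → ℝ :=
  Projectivization.lift (fun v => v.1.2 / v.1.1) (by
    rintro ⟨⟨a, a'⟩, ha⟩ ⟨⟨b, b'⟩, hb⟩ t h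
    obtain ⟨rfl, rfl⟩ : a = t * b ∧ a' = t * b' := by simpa [Prod.ext_iff] using h
    have ht : t ≠ 0 := by rintro rfl; simp at ha
    exact mul_div_mul_left b' b ht)

/-- The coordinate `α / β` of the direction of `(α, β)`, meaningful for `β ≠ 0`. -/
noncomputable def coslope : PlaneDirection → ℝ :=
  Projectivization.lift (fun v => v.1.1 / v.1.2) (by
    rintro ⟨⟨a, a'⟩, ha⟩ ⟨⟨b, b'⟩, hb⟩ t h
    obtain ⟨rfl, rfl⟩ : a = t * b ∧ a' = t * b' := by simpa [Prod.ext_iff] using h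
    have ht : t ≠ 0 := by rintro rfl; simp at ha
    exact mul_div_mul_left b b' ht)

@[simp] theorem slope_ofSlope (z : ℝ) : slope (ofSlope z) = z := div_one z

@[simp] theorem coslope_ofCoslope (z : ℝ) : coslope (ofCoslope z) = z := div_one z

@[simp] theorem coslope_ofSlope (z : ℝ) : coslope (ofSlope z) = z⁻¹ := one_div z

@[simp] theorem slope_ofCoslope (z : ℝ) : slope (ofCoslope z) = z⁻¹ := one_div z

theorem ofSlope_ne (z : ℝ) : ofSlope z ≠ ofCoslope 0 := by
  simp [ofSlope, ofCoslope, Projectivization.mk_eq_mk_iff']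

theorem ofCoslope_ne (z : ℝ) : ofCoslope z ≠ ofSlope 0 := by
  simp [ofSlope, ofCoslope, Projectivization.mk_eq_mk_iff']

theorem ofSlope_eq_iff (z : ℝ) : ofSlope z = ofSlope 0 ↔ z = 0 := by
  constructor
  · intro h
    simpa using congrArg slope h
  · rintro rfl
    rfl

theorem ofCoslope_eq_iff (z : ℝ) : ofCoslope z = ofCoslope 0 ↔ z = 0 := by
  constructor
  · intro h
    simpa using congrArg coslope h
  · rintro rfl
    rfl

theorem ofSlope_slope {l : PlaneDirection} (hl : l ≠ ofCoslope 0) : ofSlope (slope l) = l := by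
  induction l using Projectivization.ind with
  | h v hv =>
    obtain ⟨a, b⟩ := v
    have ha : a ≠ 0 := by
      rintro rfl
      exact hl ((Projectivization.mk_eq_mk_iff' ℝ _ _ _ _).2 ⟨b, by simp⟩)
    refine (Projectivization.mk_eq_mk_iff' ℝ _ _ _ _).2 ⟨a⁻¹, ?_⟩
    change a⁻¹ • (a, b) = (1, b / a)
    simp [ha, div_eq_inv_mul]

theorem ofCoslope_coslope {l : PlaneDirection} (hl : l ≠ ofSlope 0) :
    ofCoslope (coslope l) = l := by
  induction l using Projectivization.ind with
  | h v hv =>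
    obtain ⟨a, b⟩ := v
    have hb : b ≠ 0 := by
      rintro rfl
      exact hl ((Projectivization.mk_eq_mk_iff' ℝ _ _ _ _).2 ⟨a, by simp⟩)
    refine (Projectivization.mk_eq_mk_iff' ℝ _ _ _ _).2 ⟨b⁻¹, ?_⟩
    change b⁻¹ • (a, b) = (a / b, 1)
    simp [hb, div_eq_inv_mul]

/-- The chart `z₁ = β / α` on the directions that are not parallel to the `y`-axis. -/
noncomputable def slopeChart : PartialEquiv PlaneDirection ℝ where
  toFun := slope
  invFun := ofSlope
  source := {l | l ≠ ofCoslope 0}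
  target := Set.univ
  map_source' _ _ := Set.mem_univ _
  map_target' z _ := ofSlope_ne z
  left_inv' _ hl := ofSlope_slope hl
  right_inv' z _ := slope_ofSlope z

/-- The chart `z₂ = α / β` on the directions that are not parallel to the `x`-axis. -/
noncomputable def coslopeChart : PartialEquiv PlaneDirection ℝ where
  toFun := coslope
  invFun := ofCoslope
  source := {l | l ≠ ofSlope 0}
  target := Set.univ
  map_source' _ _ := Set.mem_univ _
  map_target' z _ := ofCoslope_ne z
  left_inv' _ hl := ofCoslope_coslope hl
  right_inv' z _ := coslope_ofCoslope z

/-- Each change of charts is either the identity of `ℝ` or `z ↦ 1 / z` on `z ≠ 0`. -/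
theorem transition {e e' : PartialEquiv PlaneDirection ℝ}
    (he : e = slopeChart ∨ e = coslopeChart) (he' : e' = slopeChart ∨ e' = coslopeChart) :
    ((e.symm.trans e').source = Set.univ ∧ ∀ z, (e.symm.trans e') z = z) ∨
      ((e.symm.trans e').source = {z | z ≠ 0} ∧ ∀ z, (e.symm.trans e') z = z⁻¹) := by
  rcases he with rfl | rfl <;> rcases he' with rfl | rfl
  · left
    constructor
    · ext z; simp [slopeChart, ofSlope_ne]
    · intro z; simp [slopeChart]
  · right
    constructor
    · ext z; simp [slopeChart, coslopeChart, ofSlope_eq_iff]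
    · intro z; simp [slopeChart, coslopeChart]
  · right
    constructor
    · ext z; simp [slopeChart, coslopeChart, ofCoslope_eq_iff]
    · intro z; simp [slopeChart, coslopeChart]
  · left
    constructor
    · ext z; simp [coslopeChart, ofCoslope_ne]
    · intro z; simp [coslopeChart]

open Classical in
/-- The two charts `z₁` and `z₂` as an atlas on the set of directions; the chart `z₁` is
preferred wherever it is defined. -/
noncomputable def core : ChartedSpaceCore ℝ PlaneDirection where
  atlas := {slopeChart, coslopeChart}
  chartAt l := if l ≠ ofCoslope 0 then slopeChart else coslopeChart
  mem_chart_source l := by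
    by_cases hl : l ≠ ofCoslope 0
    · rw [if_pos hl]
      exact hl
    · rw [if_neg hl]
      rw [not_not.1 hl]
      exact ofCoslope_ne 0
  chart_mem_atlas l := by
    by_cases hl : l ≠ ofCoslope 0
    · simp [if_pos hl]
    · simp [if_neg hl]
  open_source e e' he he' := by
    rcases transition he he' with ⟨h, -⟩ | ⟨h, -⟩ <;> rw [h]
    · exact isOpen_univ
    · exact isOpen_ne
  continuousOn_toFun e e' he he' := by
    rcases transition he he' with ⟨h, h'⟩ | ⟨h, h'⟩ <;> rw [h]
    · exact continuousOn_id.congr fun z _ => h' z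
    · exact continuousOn_inv₀.congr fun z _ => h' z

noncomputable instance : TopologicalSpace PlaneDirection := core.toTopologicalSpace

noncomputable instance : ChartedSpace ℝ PlaneDirection := core.toChartedSpace

instance : IsManifold 𝓘(ℝ, ℝ) ∞ PlaneDirection := by
  apply isManifold_of_contDiffOn
  intro e e' he he'
  obtain ⟨f, hf, rfl⟩ : ∃ f, ∃ hf : f ∈ core.atlas, e = core.openPartialHomeomorph f hf := by
    change e ∈ ⋃ (f : PartialEquiv PlaneDirection ℝ) (hf : f ∈ core.atlas),
      {core.openPartialHomeomorph f hf} at he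
    simpa only [Set.mem_iUnion, Set.mem_singleton_iff] using he
  obtain ⟨f', hf', rfl⟩ : ∃ f, ∃ hf : f ∈ core.atlas, e' = core.openPartialHomeomorph f hf := by
    change e' ∈ ⋃ (f : PartialEquiv PlaneDirection ℝ) (hf : f ∈ core.atlas),
      {core.openPartialHomeomorph f hf} at he'
    simpa only [Set.mem_iUnion, Set.mem_singleton_iff] using he'
  change ContDiffOn ℝ ∞ (f.symm.trans f') ((f.symm.trans f').source ∩ Set.range id)
  rw [Set.range_id, Set.inter_univ]
  rcases transition hf hf' with ⟨h, h'⟩ | ⟨h, h'⟩ <;> rw [h]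
  · exact contDiffOn_id.congr fun z _ => h' z
  · exact contDiffOn_id.inv (fun z hz => hz) |>.congr fun z _ => h' z

end PlaneDirection

/-- The space of first jets `J¹(ℝ²)`: pairs of a point `p` of the plane and a direction at `p`,
the tangent space `T_p ℝ²` being identified with `ℝ²`. As a product, it carries the smooth
structure given by the charts `(x, y, z₁)` and `(x, y, z₂)`. -/
abbrev J1 : Type := Plane × PlaneDirection

/-- The model with corners of the three-dimensional manifold `J1`. -/
noncomputable abbrev J1Model : ModelWithCorners ℝ (Plane × ℝ) (ModelProd Plane ℝ) :=
  𝓘(ℝ, Plane).prod 𝓘(ℝ, ℝ)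

/-- The projection `π : J¹(ℝ²) → ℝ²`. -/
def J1.proj (q : J1) : Plane := q.1

/-- The direction `q` as a one-dimensional subspace of the tangent space of the plane. -/
noncomputable def J1.line (q : J1) : Submodule ℝ (TangentSpace 𝓘(ℝ, Plane) (J1.proj q)) :=
  q.2.submodule

/-! ## Families of tangent subspaces and direction fields -/

section Fields

variable {V H : Type*} [NormedAddCommGroup V] [NormedSpace ℝ V] [TopologicalSpace H]
  (I : ModelWithCorners ℝ V H) {M : Type*} [TopologicalSpace M] [ChartedSpace H M]

/-- A family of linear subspaces of the tangent spaces of `M`. -/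
abbrev TangentFamily (M : Type*) [TopologicalSpace M] [ChartedSpace H M] : Type _ :=
  ∀ q : M, Submodule ℝ (TangentSpace I q)

variable [IsManifold I ∞ M]

/-- Near the point `p`, the vector field `X` is smooth and nowhere zero, and it generates `E`. -/
def GeneratesAt (X : ∀ q : M, TangentSpace I q) (E : TangentFamily I M) (p : M) : Prop :=
  ∀ᶠ q in 𝓝 p, ContMDiffAt I I.tangent ∞ (fun r => (⟨r, X r⟩ : TangentBundle I M)) q ∧
    X q ≠ 0 ∧ E q = Submodule.span ℝ {X q}

/-- `E` is a smooth direction field (a one-dimensional distribution) in a neighbourhood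
of `p`. -/
def IsDirectionFieldAt (E : TangentFamily I M) (p : M) : Prop :=
  ∃ X : ∀ q : M, TangentSpace I q, GeneratesAt I X E p

end Fields

/-- Families of tangent subspaces of the three-dimensional space. -/
abbrev SpaceFamily : Type := TangentFamily 𝓘(ℝ, Space) Space

/-- Families of tangent subspaces of `J¹(ℝ²)`. -/
abbrev J1Family : Type := TangentFamily J1Model J1

/-- `(E₁, E₂)` is a nondegenerate pair of direction fields at the point `p` of the space: near `p`
both are smooth direction fields, they differ at `p` (hence near `p`), and the distribution
`E₁ ⊕ E₂` is not integrable at `p`: the bracket of a generator of `E₁` and a generator of `E₂`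
does not lie in `E₁ ⊕ E₂` at `p` (a condition which does not depend on the generators). -/
def IsNondegeneratePairAt (E₁ E₂ : SpaceFamily) (p : Space) : Prop :=
  E₁ p ≠ E₂ p ∧ ∃ X₁ X₂ : ∀ r : Space, TangentSpace 𝓘(ℝ, Space) r,
    GeneratesAt 𝓘(ℝ, Space) X₁ E₁ p ∧ GeneratesAt 𝓘(ℝ, Space) X₂ E₂ p ∧
      VectorField.mlieBracket 𝓘(ℝ, Space) X₁ X₂ p ∉ E₁ p ⊔ E₂ p

/-- The pairs of direction fields `(E₁, E₂)` near `p` and `(E₁', E₂')` near `p'` are locally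
equivalent: some local diffeomorphism of the space takes `p` to `p'` and, near `p`, takes `E₁` to
`E₁'` and `E₂` to `E₂'`. -/
def PairsLocallyEquivalent (E₁ E₂ : SpaceFamily) (p : Space) (E₁' E₂' : SpaceFamily)
    (p' : Space) : Prop :=
  ∃ f : Space → Space, IsLocalDiffeomorphAt 𝓘(ℝ, Space) 𝓘(ℝ, Space) ∞ f p ∧ f p = p' ∧
    ∀ᶠ r in 𝓝 p,
      (E₁ r).map (mfderiv 𝓘(ℝ, Space) 𝓘(ℝ, Space) f r).toLinearMap = E₁' (f r) ∧
      (E₂ r).map (mfderiv 𝓘(ℝ, Space) 𝓘(ℝ, Space) f r).toLinearMap = E₂' (f r)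

/-! ## Second-order equations in the plane -/

/-- The vertical direction field `V_q = ker d_qπ` on `J¹(ℝ²)`. -/
noncomputable def verticalField : J1Family := fun q =>
  (mfderiv J1Model 𝓘(ℝ, Plane) J1.proj q).toLinearMap.ker

/-- The contact distribution on `J¹(ℝ²)`: `C_q` consists of the tangent vectors at `q` whose
projection to the plane lies in the direction `q`. -/
noncomputable def contactDistribution : J1Family := fun q =>
  (J1.line q).comap (mfderiv J1Model 𝓘(ℝ, Plane) J1.proj q).toLinearMap

/-- A second-order equation in the plane (solved for the highest derivative), near the point `q`
of `J¹(ℝ²)`: a smooth direction field which lies in the contact distribution and is nowhere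
vertical. In the chart `(x, y, z)`, the equation `y'' = F(x, y, y')` is the field generated by
`∂/∂x + z ∂/∂y + F(x, y, z) ∂/∂z`. -/
def IsSecondOrderEquationAt (E : J1Family) (q : J1) : Prop :=
  IsDirectionFieldAt J1Model E q ∧
    ∀ᶠ r in 𝓝 q, E r ≤ contactDistribution r ∧ E r ≠ verticalField r

open Classical in
/-- The prolongation `φ⁽¹⁾ : l_p ↦ (d_pφ)(l_p)` of a map `φ` of the plane. (At the points where
`d_pφ` is not injective, `d_pφ(l_p)` need not be a direction, and the direction is left
unchanged.) -/
noncomputable def prolongation (φ : Plane → Plane) : J1 → J1 := fun q =>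
  (φ q.1, if h : Function.Injective (fderiv ℝ φ q.1).toLinearMap then
    Projectivization.map (fderiv ℝ φ q.1).toLinearMap h q.2 else q.2)

/-- The second-order equations `E` near `q` and `E'` near `q'` are locally equivalent (under point
transformations): there is a local diffeomorphism of the plane whose prolongation takes `q` to
`q'` and, near `q`, takes `E` to `E'`. -/
def EquationsLocallyEquivalent (E : J1Family) (q : J1) (E' : J1Family) (q' : J1) : Prop :=
  ∃ φ : Plane → Plane, IsLocalDiffeomorphAt 𝓘(ℝ, Plane) 𝓘(ℝ, Plane) ∞ φ (J1.proj q) ∧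
    prolongation φ q = q' ∧
    ∀ᶠ r in 𝓝 q,
      (E r).map (mfderiv J1Model J1Model (prolongation φ) r).toLinearMap = E' (prolongation φ r)

/-- `E`, near `q`, is a second-order equation that corresponds to the pair `(E₁, E₂)` near `p`:
some local diffeomorphism `Φ` of the space to `J¹(ℝ²)` takes `p` to `q` and, near `p`, takes
`(E₁ ⊕ E₂, E₁)` to the contact distribution and the vertical field, and `E₂` to `E`. -/
def CorrespondsAt (E₁ E₂ : SpaceFamily) (p : Space) (E : J1Family) (q : J1) : Prop :=
  ∃ Φ : Space → J1, IsLocalDiffeomorphAt 𝓘(ℝ, Space) J1Model ∞ Φ p ∧ Φ p = q ∧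
    ∀ᶠ r in 𝓝 p,
      (E₁ r ⊔ E₂ r).map (mfderiv 𝓘(ℝ, Space) J1Model Φ r).toLinearMap =
        contactDistribution (Φ r) ∧
      (E₁ r).map (mfderiv 𝓘(ℝ, Space) J1Model Φ r).toLinearMap = verticalField (Φ r) ∧
      (E₂ r).map (mfderiv 𝓘(ℝ, Space) J1Model Φ r).toLinearMap = E (Φ r)

/-! The correspondence rests on a normal form. Let `X₁`, `X₂` generate a nondegenerate pair. Two
independent first integrals `ψ` of `X₁` project the space locally to a plane whose fibres are the
trajectories of `X₁`. Send a point to its image under `ψ` together with the direction of `dψ(X₂)`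
there. Since `dψ(X₁) = 0` identically, the derivative of `dψ(X₂)` along `X₁` is `dψ([X₁, X₂])`, and
nondegeneracy says exactly that this direction turns at nonzero speed along each fibre. Hence the
map is a local diffeomorphism to the jet space. It makes `E₁` vertical and sends `X₂` to a vector
projecting into the marked direction, so `E₁ ⊕ E₂` becomes the contact distribution
(`exists_adaptedCoordinates`, `IsNondegeneratePairAt.exists_correspondsAt`).

For the equivalence, corresponding maps turn an equivalence of pairs into a local diffeomorphism `Ψ`
of the jet space preserving the vertical field and the contact distribution. The first property
makes `Ψ` permute fibres and so cover a map `φ` of the plane (`Carries.eventually_fst_eq`); the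
second forces it to move directions by `dφ`, so `Ψ` is the prolongation of `φ`
(`exists_eq_prolongation`). Conversely, a prolongation preserves the vertical field, so an
equivalence of equations pulls back to one of pairs.

The first integrals come from a smooth local flow (`exists_smooth_localFlow`). It is obtained by the
inverse function theorem in the Banach space of continuous paths, where smooth dependence on initial
data is automatic once superposition `β ↦ f ∘ β` is known to be smooth. -/

/-! ## Superposition operators on spaces of continuous functions -/

section Superposition

variable {K : Type*} [TopologicalSpace K] [CompactSpace K]
  {E F : Type} [NormedAddCommGroup E] [NormedSpace ℝ E] [NormedAddCommGroup F] [NormedSpace ℝ F]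

/-- A continuous family of operators, acting pointwise on continuous functions. -/
noncomputable def pointwiseApply :
    C(K, E →L[ℝ] F) →L[ℝ] C(K, E) →L[ℝ] C(K, F) :=
  LinearMap.mkContinuous₂
    (LinearMap.mk₂ ℝ (fun (A : C(K, E →L[ℝ] F)) (h : C(K, E)) => (⟨fun t => A t (h t), by fun_prop⟩ : C(K, F)))
      (fun _ _ _ => by ext; simp) (fun _ _ _ => by ext; simp)
      (fun _ _ _ => by ext; simp) (fun _ _ _ => by ext; simp)) 1 (by
    intro A h
    rw [one_mul, ContinuousMap.norm_le _ (by positivity)]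
    intro t
    exact (A t).le_of_opNorm_le_of_le (A.norm_coe_le_norm t) (h.norm_coe_le_norm t))

@[simp] theorem pointwiseApply_apply (A : C(K, E →L[ℝ] F)) (h : C(K, E)) (t : K) :
    pointwiseApply A h t = A t (h t) := rfl

/-- The mean value inequality at each point of `K` gives the pointwise estimate. It is uniform over
`K` because `β ↦ f' ∘ β` is continuous for the sup norm. -/
theorem hasFDerivAt_superposition {f : E → F} {f' : E → E →L[ℝ] F} (hf : Continuous f)
    (hf' : Continuous f') (hff' : ∀ x, HasFDerivAt f (f' x) x) (α : C(K, E)) :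
    HasFDerivAt (fun β : C(K, E) => (⟨f, hf⟩ : C(E, F)).comp β)
      (pointwiseApply ((⟨f', hf'⟩ : C(E, E →L[ℝ] F)).comp α)) α := by
  rw [hasFDerivAt_iff_isLittleO, Asymptotics.isLittleO_iff]
  intro ε hε
  have hc : Continuous fun β : C(K, E) => (⟨f', hf'⟩ : C(E, E →L[ℝ] F)).comp β :=
    ContinuousMap.continuous_postcomp _
  obtain ⟨δ, hδ, hc⟩ := (Metric.continuous_iff (α := C(K, E)) (β := C(K, E →L[ℝ] F))).1 hc α ε hε
  filter_upwards [Metric.ball_mem_nhds α hδ] with β hβ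
  rw [ContinuousMap.norm_le _ (by positivity)]
  intro t
  have key : ‖f (β t) - f (α t) - f' (α t) (β t - α t)‖ ≤ ε * ‖β t - α t‖ := by
    refine (convex_segment (α t) (β t)).norm_image_sub_le_of_norm_hasFDerivWithin_le'
      (fun x _ => (hff' x).hasFDerivWithinAt) ?_ (left_mem_segment ℝ _ _)
      (right_mem_segment ℝ _ _)
    intro x hx
    rw [segment_eq_image'] at hx
    obtain ⟨s, hs, rfl⟩ := hx
    -- A point of the segment from `α t` to `β t` is the value at `t` of a path on the segment from
    -- `α` to `β`, which stays in the `δ`-ball.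
    have hd : dist (α + s • (β - α)) α < δ := by
      rw [dist_eq_norm, add_sub_cancel_left, norm_smul, Real.norm_of_nonneg hs.1]
      refine lt_of_le_of_lt (mul_le_of_le_one_left (norm_nonneg _) hs.2) ?_
      rwa [← dist_eq_norm]
    have h1 := ContinuousMap.dist_lt_iff hε |>.1 (hc _ hd) t
    rw [dist_eq_norm] at h1
    exact h1.le
  refine key.trans ?_
  gcongr
  exact (β - α).norm_coe_le_norm t

/-- The derivative is again a superposition operator, by `f'`, followed by a continuous linear map.
The target `F` is quantified inside the induction because `f'` takes values in `E →L[ℝ] F`. -/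
theorem contDiff_nat_superposition (n : ℕ) :
    ∀ {F : Type} [NormedAddCommGroup F] [NormedSpace ℝ F] {f : E → F} (hf : ContDiff ℝ n f),
      ContDiff ℝ n (fun β : C(K, E) => (⟨f, hf.continuous⟩ : C(E, F)).comp β) := by
  induction n with
  | zero =>
    intro F _ _ f hf
    exact contDiff_zero.2 (ContinuousMap.continuous_postcomp _)
  | succ n ih =>
    intro F _ _ f hf
    obtain ⟨f', hf', hff'⟩ := contDiff_succ_iff_hasFDerivAt.1 (by exact_mod_cast hf)
    have : ContDiff ℝ (n + 1) (fun β : C(K, E) => (⟨f, hf.continuous⟩ : C(E, F)).comp β) :=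
      contDiff_succ_iff_hasFDerivAt.2 ⟨_, (pointwiseApply (K := K)).contDiff.comp (ih hf'),
        hasFDerivAt_superposition hf.continuous hf'.continuous hff'⟩
    exact_mod_cast this

theorem contDiff_superposition {f : E → F} (hf : ContDiff ℝ ∞ f) :
    ContDiff ℝ ∞ (fun β : C(K, E) => (⟨f, hf.continuous⟩ : C(E, F)).comp β) :=
  contDiff_infty.2 fun n => contDiff_nat_superposition n (hf.of_le (mod_cast le_top))

end Superposition

/-! ## The inverse function theorem -/

section InverseFunction

variable {E F : Type*} [NormedAddCommGroup E] [NormedSpace ℝ E] [CompleteSpace E]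
  [NormedAddCommGroup F] [NormedSpace ℝ F]

/-- The inverse function theorem, for a map which is smooth in a neighbourhood of a point. -/
theorem exists_smooth_localInverse {f : E → F} {a : E} (hf : ∀ᶠ x in 𝓝 a, ContDiffAt ℝ ∞ f x)
    {f' : E ≃L[ℝ] F} (hf' : HasFDerivAt f (f' : E →L[ℝ] F) a) :
    ∃ g : OpenPartialHomeomorph E F, (g : E → F) = f ∧ a ∈ g.source ∧
      ∀ᶠ y in 𝓝 (f a), ContDiffAt ℝ ∞ g.symm y := by
  have h0 : (∞ : WithTop ℕ∞) ≠ 0 := by simp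
  let g := hf.self_of_nhds.toOpenPartialHomeomorph f hf' h0
  have hga : a ∈ g.source := hf.self_of_nhds.mem_toOpenPartialHomeomorph_source hf' h0
  refine ⟨g, rfl, hga, ?_⟩
  -- Smoothness of the inverse at a nearby point needs an invertible derivative there; invertible
  -- operators form an open set.
  have hinv : ∀ᶠ x in 𝓝 a, ∃ e : E ≃L[ℝ] F, (e : E →L[ℝ] F) = fderiv ℝ f x := by
    have hc : ContinuousAt (fderiv ℝ f) a := hf.self_of_nhds.continuousAt_fderiv h0
    refine hc.eventually (p := fun A => A ∈ Set.range ((↑) : (E ≃L[ℝ] F) → E →L[ℝ] F)) ?_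
    exact ContinuousLinearEquiv.isOpen.mem_nhds ⟨f', hf'.fderiv.symm⟩
  have hsymm : Filter.Tendsto g.symm (𝓝 (f a)) (𝓝 a) := g.tendsto_symm hga
  filter_upwards [hsymm.eventually (hf.and hinv), g.open_target.mem_nhds (g.map_source hga)]
    with y ⟨hy, e, he⟩ hyt
  refine g.contDiffAt_symm hyt (f₀' := e) ?_ hy
  rw [he]
  exact (hy.differentiableAt h0).hasFDerivAt

end InverseFunction

/-! ## Local flows of smooth vector fields -/

section Flow

open unitInterval

variable {E : Type} [NormedAddCommGroup E] [NormedSpace ℝ E]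

/-- The primitive `τ ↦ ∫ t in 0..τ, α t` of a continuous path on the unit interval. -/
noncomputable def pathPrimitive : C(I, E) →L[ℝ] C(I, E) :=
  LinearMap.mkContinuous
    { toFun := fun α => ⟨fun τ => ∫ t in (0 : ℝ)..τ, α (Set.projIcc 0 1 zero_le_one t), by
        have hc : Continuous fun t : ℝ => α (Set.projIcc 0 1 zero_le_one t) :=
          α.continuous.comp continuous_projIcc
        exact (intervalIntegral.continuous_primitive
          (fun a b => hc.intervalIntegrable a b) 0).comp continuous_subtype_val⟩
      map_add' := by
        intro α β
        ext τ
        exact intervalIntegral.integral_add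
          ((α.continuous.comp continuous_projIcc).intervalIntegrable _ _)
          ((β.continuous.comp continuous_projIcc).intervalIntegrable _ _)
      map_smul' := by
        intro c α
        ext τ
        exact intervalIntegral.integral_smul c _ } 1 (by
    intro α
    rw [one_mul, ContinuousMap.norm_le _ (norm_nonneg _)]
    intro τ
    refine (intervalIntegral.norm_integral_le_of_norm_le_const
      (fun t _ => α.norm_coe_le_norm _)).trans ?_
    rw [sub_zero, abs_of_nonneg τ.2.1]
    exact mul_le_of_le_one_right (norm_nonneg _) τ.2.2)

theorem pathPrimitive_apply (α : C(I, E)) (τ : I) :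
    pathPrimitive α τ = ∫ t in (0 : ℝ)..τ, α (Set.projIcc 0 1 zero_le_one t) := rfl

/-- Multiplication by a fixed number as a self-map of the unit interval. -/
def unitIntervalMul (τ : I) : C(I, I) := ⟨fun ρ => τ * ρ, by fun_prop⟩

/-- Linear substitution in the integral: slowing a path down by `τ` scales its primitive. This gives
the flow its compatibility with rescaling of time. -/
theorem pathPrimitive_comp_mul (α : C(I, E)) (τ ρ : I) :
    pathPrimitive α (τ * ρ) = (τ : ℝ) • pathPrimitive (α.comp (unitIntervalMul τ)) ρ := by
  rw [pathPrimitive_apply, pathPrimitive_apply]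
  have h := intervalIntegral.smul_integral_comp_mul_left (a := 0) (b := (ρ : ℝ))
    (fun t => α (Set.projIcc 0 1 zero_le_one t)) (τ : ℝ)
  rw [mul_zero] at h
  rw [Set.Icc.coe_mul, ← h]
  congr 1
  apply intervalIntegral.integral_congr
  intro t ht
  rw [Set.uIcc_of_le ρ.2.1] at ht
  have ht' : t ∈ Set.Icc (0 : ℝ) 1 := ⟨ht.1, ht.2.trans ρ.2.2⟩
  have ht'' : (τ : ℝ) * t ∈ Set.Icc (0 : ℝ) 1 :=
    ⟨mul_nonneg τ.2.1 ht'.1, mul_le_one₀ τ.2.2 ht'.1 ht'.2⟩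
  simp only [ContinuousMap.comp_apply]
  congr 1
  rw [Set.projIcc_of_mem _ ht', Set.projIcc_of_mem _ ht'']
  rfl

variable [CompleteSpace E]

/-- A smooth vector field on a Banach space has a smooth local flow near every point. -/
theorem exists_smooth_localFlow {X : E → E} (hX : ContDiff ℝ ∞ X) (x₀ : E) :
    ∃ Φ : ℝ × E → E,
      (∀ᶠ u in 𝓝 ((0 : ℝ), x₀), ContDiffAt ℝ ∞ Φ u ∧
        HasDerivAt (fun t => Φ (t, u.2)) (X (Φ u)) u.1) ∧
      ∀ᶠ x in 𝓝 x₀, Φ (0, x) = x := by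
  let S : C(I, E) → C(I, E) := fun α => (⟨X, hX.continuous⟩ : C(E, E)).comp α
  have hS : ContDiff ℝ ∞ S := contDiff_superposition hX
  let cst : E →L[ℝ] C(I, E) := ContinuousLinearMap.const ℝ I
  have hcst : ∀ (x : E) (t : I), cst x t = x := fun x t => rfl
  -- The last component vanishes exactly when `α τ = x + s ∫₀^τ X (α t) dt`, that is, when `α` is
  -- the trajectory from `x` run over time `s` and rescaled to the unit interval. At `s = 0` its
  -- derivative in `α` is the identity, so `H` is locally invertible.
  let H : (ℝ × E) × C(I, E) → (ℝ × E) × C(I, E) := fun u =>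
    (u.1, u.2 - cst u.1.2 - u.1.1 • pathPrimitive (S u.2))
  have hH : ContDiff ℝ ∞ H := by
    refine contDiff_fst.prodMk ((contDiff_snd.sub (cst.contDiff.comp
      (contDiff_snd.comp contDiff_fst))).sub ((contDiff_fst.comp contDiff_fst).smul ?_))
    exact (pathPrimitive (E := E)).contDiff.comp (hS.comp contDiff_snd)
  let a : (ℝ × E) × C(I, E) := ((0, x₀), cst x₀)
  have hHa : H a = ((0, x₀), 0) := by simp [H, a]
  have hHd : HasFDerivAt H ((ContinuousLinearEquiv.skewProd (.refl ℝ (ℝ × E)) (.refl ℝ C(I, E))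
      (-(cst.comp (.snd ℝ ℝ E)) - (ContinuousLinearMap.fst ℝ ℝ E).smulRight
        (pathPrimitive (S (cst x₀)))) : ((ℝ × E) × C(I, E)) ≃L[ℝ] (ℝ × E) × C(I, E)) :
      (ℝ × E) × C(I, E) →L[ℝ] (ℝ × E) × C(I, E)) a := by
    have hd : DifferentiableAt ℝ (fun u : (ℝ × E) × C(I, E) => pathPrimitive (S u.2)) a :=
      (((pathPrimitive (E := E)).contDiff.comp (hS.comp contDiff_snd)).differentiable (by simp)) a
    have h1 := (hasFDerivAt_fst (𝕜 := ℝ) (p := a)).prodMk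
      (((hasFDerivAt_snd (𝕜 := ℝ) (p := a)).sub (cst.hasFDerivAt.comp a
        ((hasFDerivAt_snd (𝕜 := ℝ) (p := a.1)).comp a hasFDerivAt_fst))).sub
        (((hasFDerivAt_fst (𝕜 := ℝ) (p := a.1)).comp a hasFDerivAt_fst).smul hd.hasFDerivAt))
    refine h1.congr_fderiv ?_
    ext u t <;> simp [a, sub_eq_add_neg]
  obtain ⟨g, hgH, hga, hgs⟩ := exists_smooth_localInverse
    (Filter.Eventually.of_forall fun u => hH.contDiffAt) hHd
  rw [hHa] at hgs
  have hgt : ((0, x₀), 0) ∈ g.target := by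
    rw [← hHa, ← hgH]
    exact g.map_source hga
  have hgsymm : g.symm ((0, x₀), 0) = a := by
    rw [← hHa, ← hgH]
    exact g.left_inv hga
  let A : ℝ × E → C(I, E) := fun u => (g.symm (u, 0)).2
  have hinc : Filter.Tendsto (fun u : ℝ × E => (u, (0 : C(I, E)))) (𝓝 (0, x₀))
      (𝓝 ((0, x₀), 0)) := Continuous.tendsto (by fun_prop) _
  have hAs : ∀ᶠ u in 𝓝 ((0 : ℝ), x₀), ContDiffAt ℝ ∞ A u := by
    filter_upwards [hinc.eventually hgs] with u hu
    exact contDiffAt_snd.comp u (hu.comp u (contDiffAt_id.prodMk contDiffAt_const))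
  have hAa : A (0, x₀) = cst x₀ := by simp only [A, hgsymm, a]
  obtain ⟨r, hr, hball⟩ := Metric.mem_nhds_iff.1 (g.open_source.mem_nhds hga)
  let Φ : ℝ × E → E := fun u => A u 1
  have hAr : ∀ᶠ u in 𝓝 ((0 : ℝ), x₀), A u ∈ Metric.ball (cst x₀) r := by
    have h := hAs.self_of_nhds.continuousAt
    rw [ContinuousAt, hAa] at h
    exact h.eventually (Metric.ball_mem_nhds _ hr)
  have hAeq : ∀ᶠ u in 𝓝 ((0 : ℝ), x₀), ∀ τ : I,
      A u τ = u.2 + u.1 • pathPrimitive (S (A u)) τ := by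
    filter_upwards [hinc.eventually (g.open_target.mem_nhds hgt)] with u hu τ
    have h1 : H (g.symm (u, 0)) = (u, 0) := by
      rw [← hgH]
      exact g.right_inv hu
    have h2 : (g.symm (u, 0)).1 = u := congrArg Prod.fst h1
    have h3 := DFunLike.congr_fun (congrArg Prod.snd h1) τ
    simp only [H, h2, ContinuousMap.sub_apply, ContinuousMap.zero_apply, sub_sub, sub_eq_zero] at h3
    exact h3
  have hAΦ : ∀ᶠ u in 𝓝 ((0 : ℝ), x₀), ∀ τ : I, Φ (τ * u.1, u.2) = A u τ := by
    filter_upwards [hAeq, hAr, Metric.ball_mem_nhds _ hr] with u hu hur hr' τ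
    -- Uniqueness: the initial part of a solution, rescaled, solves the problem for time `τ * u.1`.
    -- It remains in the region where `H` is injective, since restricting a path does not increase
    -- its sup distance to the constant path, so it equals `A (τ * u.1, u.2)`.
    have hH1 : H ((τ * u.1, u.2), (A u).comp (unitIntervalMul τ)) = ((τ * u.1, u.2), 0) := by
      refine Prod.ext rfl ?_
      ext ρ
      have h1 := hu (τ * ρ)
      rw [pathPrimitive_comp_mul] at h1
      have h2 : ((A u).comp (unitIntervalMul τ)) ρ = A u (τ * ρ) := rfl
      have h3 : (S (A u)).comp (unitIntervalMul τ) = S ((A u).comp (unitIntervalMul τ)) := rfl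
      simp only [H, ContinuousMap.sub_apply, ContinuousMap.smul_apply, hcst,
        ContinuousMap.zero_apply, h2, h1, h3, smul_smul]
      rw [mul_comm u.1]
      abel
    have hmem : ((τ * u.1, u.2), (A u).comp (unitIntervalMul τ)) ∈ g.source := by
      apply hball
      rw [Metric.mem_ball, Prod.dist_eq] at hr' ⊢
      rw [Prod.dist_eq (x := (↑τ * u.1, u.2))]
      simp only [max_lt_iff] at hr' ⊢
      refine ⟨⟨?_, hr'.2⟩, ?_⟩
      · refine lt_of_le_of_lt ?_ hr'.1
        simp only [a, dist_zero_right, norm_mul, Real.norm_of_nonneg τ.2.1]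
        exact mul_le_of_le_one_left (norm_nonneg _) τ.2.2
      · rw [ContinuousMap.dist_lt_iff hr]
        intro ρ
        exact (ContinuousMap.dist_lt_iff hr).1 hur (τ * ρ)
    have h4 : g.symm ((τ * u.1, u.2), 0) = ((τ * u.1, u.2), (A u).comp (unitIntervalMul τ)) := by
      rw [← hH1, ← hgH]
      exact g.left_inv hmem
    simp only [Φ, A, h4]
    change A u (τ * 1) = A u τ
    rw [mul_one]
  have hΦ : ∀ᶠ u in 𝓝 ((0 : ℝ), x₀), ContDiffAt ℝ ∞ Φ u ∧
      Φ u = u.2 + ∫ t in (0 : ℝ)..u.1, X (Φ (t, u.2)) := by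
    filter_upwards [hAs, hAeq, hAΦ] with u hu hu1 hu2
    refine ⟨(ContinuousMap.evalCLM ℝ (M := E) (1 : I)).contDiff.contDiffAt.comp u hu, ?_⟩
    have h1 := hu1 1
    rw [pathPrimitive_apply, Set.Icc.coe_one] at h1
    change A u 1 = _
    rw [h1]
    congr 1
    have h2 := intervalIntegral.smul_integral_comp_mul_left (a := 0) (b := 1)
      (fun t => X (Φ (t, u.2))) u.1
    rw [mul_zero, mul_one] at h2
    rw [← h2]
    congr 1
    apply intervalIntegral.integral_congr
    intro t ht
    rw [Set.uIcc_of_le zero_le_one] at ht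
    change X (A u (Set.projIcc 0 1 zero_le_one t)) = X (Φ (u.1 * t, u.2))
    rw [Set.projIcc_of_mem _ ht, ← hu2, mul_comm]
  obtain ⟨ε, hε, hΦε⟩ := Metric.eventually_nhds_iff_ball.1 hΦ
  -- Balls of the product are products of balls, so all times between `0` and `s` are covered
  -- together with `(s, x)`.
  have hmem : ∀ {t : ℝ} {x : E}, (t, x) ∈ Metric.ball ((0 : ℝ), x₀) ε ↔
      t ∈ Metric.ball 0 ε ∧ x ∈ Metric.ball x₀ ε := by
    intro t x
    simp [Prod.dist_eq]
  refine ⟨Φ, ?_, ?_⟩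
  · filter_upwards [Metric.ball_mem_nhds _ hε] with u hu
    refine ⟨(hΦε u hu).1, ?_⟩
    obtain ⟨s, x⟩ := u
    have hu' := hmem.1 hu
    have hcont : ContinuousOn (fun t => X (Φ (t, x))) (Metric.ball 0 ε) := by
      intro t ht
      refine ContinuousAt.continuousWithinAt (hX.continuous.continuousAt.comp ?_)
      exact ContinuousAt.comp (f := fun t : ℝ => (t, x))
        (hΦε (t, x) (hmem.2 ⟨ht, hu'.2⟩)).1.continuousAt (by fun_prop)
    have hint : IntervalIntegrable (fun t => X (Φ (t, x))) MeasureTheory.volume 0 s := by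
      refine (hcont.mono ?_).intervalIntegrable
      rw [← segment_eq_uIcc]
      exact (convex_ball _ _).segment_subset (Metric.mem_ball_self hε) hu'.1
    have hder := (intervalIntegral.integral_hasDerivAt_right hint
      (hcont.stronglyMeasurableAtFilter Metric.isOpen_ball s hu'.1)
      (hcont.continuousAt (Metric.isOpen_ball.mem_nhds hu'.1))).const_add x
    refine hder.congr_of_eventuallyEq ?_
    filter_upwards [Metric.isOpen_ball.mem_nhds hu'.1] with t ht
    exact (hΦε (t, x) (hmem.2 ⟨ht, hu'.2⟩)).2
  · filter_upwards [Metric.ball_mem_nhds x₀ hε] with x hx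
    have h := (hΦε (0, x) (hmem.2 ⟨Metric.mem_ball_self hε, hx⟩)).2
    rwa [intervalIntegral.integral_same, add_zero] at h

end Flow

/-! ## Local diffeomorphisms and families of tangent subspaces -/

section LocalDiffeomorphism

variable {V H W H' U H'' : Type*} [NormedAddCommGroup V] [NormedSpace ℝ V] [TopologicalSpace H]
  [NormedAddCommGroup W] [NormedSpace ℝ W] [TopologicalSpace H']
  [NormedAddCommGroup U] [NormedSpace ℝ U] [TopologicalSpace H'']
  {I : ModelWithCorners ℝ V H} {J : ModelWithCorners ℝ W H'} {K : ModelWithCorners ℝ U H''}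
  {M N P : Type*} [TopologicalSpace M] [ChartedSpace H M] [TopologicalSpace N]
  [ChartedSpace H' N] [TopologicalSpace P] [ChartedSpace H'' P]

theorem IsLocalDiffeomorphAt.eventually {f : M → N} {x : M}
    (hf : IsLocalDiffeomorphAt I J ∞ f x) :
    ∀ᶠ r in 𝓝 x, IsLocalDiffeomorphAt I J ∞ f r := by
  obtain ⟨e, hx, he⟩ := hf
  filter_upwards [e.open_source.mem_nhds hx] with r hr
  exact ⟨e, hr, he⟩

theorem IsLocalDiffeomorphAt.eventually_mdifferentiableAt {f : M → N} {x : M}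
    (hf : IsLocalDiffeomorphAt I J ∞ f x) : ∀ᶠ r in 𝓝 x, MDifferentiableAt I J f r :=
  hf.eventually.mono fun _ hr => hr.mdifferentiableAt (by simp)

theorem IsLocalDiffeomorphAt.mfderiv_injective {f : M → N} {x : M}
    (hf : IsLocalDiffeomorphAt I J ∞ f x) : Function.Injective (mfderiv I J f x) := by
  have h := (hf.mfderivToContinuousLinearEquiv (by simp)).injective
  rwa [← ContinuousLinearEquiv.coe_coe, hf.mfderivToContinuousLinearEquiv_coe] at h

theorem IsLocalDiffeomorphAt.exists_inverse {f : M → N} {x : M}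
    (hf : IsLocalDiffeomorphAt I J ∞ f x) :
    ∃ g : N → M, IsLocalDiffeomorphAt J I ∞ g (f x) ∧ g (f x) = x ∧
      (∀ᶠ r in 𝓝 x, g (f r) = r) ∧ ∀ᶠ y in 𝓝 (f x), f (g y) = y :=
  ⟨hf.localInverse, hf.localInverse_isLocalDiffeomorphAt,
    hf.localInverse_left_inv hf.localInverse_mem_target, hf.localInverse_eventuallyEq_left,
    hf.localInverse_eventuallyEq_right⟩

/-- The domains are cut to `A ∩ f ⁻¹' B` and `B ∩ g ⁻¹' A`; the inverse relations then make each map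
send one into the other. -/
theorem isLocalDiffeomorphAt_of_inverse {f : M → N} {g : N → M} {x : M}
    (hf : ∀ᶠ r in 𝓝 x, ContMDiffAt I J ∞ f r)
    (hg : ∀ᶠ y in 𝓝 (f x), ContMDiffAt J I ∞ g y)
    (hgf : ∀ᶠ r in 𝓝 x, g (f r) = r) (hfg : ∀ᶠ y in 𝓝 (f x), f (g y) = y) :
    IsLocalDiffeomorphAt I J ∞ f x := by
  obtain ⟨A, hA, hAo, hxA⟩ := eventually_nhds_iff.1 (hf.and hgf)
  obtain ⟨B, hB, hBo, hxB⟩ := eventually_nhds_iff.1 (hg.and hfg)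
  have hfA : ContinuousOn f A := fun r hr => (hA r hr).1.continuousAt.continuousWithinAt
  have hgB : ContinuousOn g B := fun r hr => (hB r hr).1.continuousAt.continuousWithinAt
  refine ⟨{ toFun := f, invFun := g, source := A ∩ f ⁻¹' B, target := B ∩ g ⁻¹' A,
            map_source' := ?_, map_target' := ?_, left_inv' := ?_, right_inv' := ?_,
            open_source := hfA.isOpen_inter_preimage hAo hBo,
            open_target := hgB.isOpen_inter_preimage hBo hAo,
            contMDiffOn_toFun := fun r hr => (hA r hr.1).1.contMDiffWithinAt,
            contMDiffOn_invFun := fun r hr => (hB r hr.1).1.contMDiffWithinAt },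
    ⟨hxA, hxB⟩, fun r _ => rfl⟩
  · intro r hr
    refine ⟨hr.2, ?_⟩
    rw [Set.mem_preimage, (hA r hr.1).2]
    exact hr.1
  · intro r hr
    refine ⟨hr.2, ?_⟩
    rw [Set.mem_preimage, (hB r hr.1).2]
    exact hr.1
  · exact fun r hr => (hA r hr.1).2
  · exact fun r hr => (hB r hr.1).2

theorem IsLocalDiffeomorphAt.congr {f g : M → N} {x : M} (hf : IsLocalDiffeomorphAt I J ∞ f x)
    (h : f =ᶠ[𝓝 x] g) : IsLocalDiffeomorphAt I J ∞ g x := by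
  obtain ⟨k, hk, hkx, hkf, hfk⟩ := hf.exists_inverse
  have hx := h.self_of_nhds
  refine isLocalDiffeomorphAt_of_inverse (g := k) ?_ ?_ ?_ ?_
  · filter_upwards [hf.eventually, h.eventuallyEq_nhds] with r hr hr'
    exact hr.contMDiffAt.congr_of_eventuallyEq hr'.symm
  · rw [← hx]
    exact hk.eventually.mono fun _ hr => hr.contMDiffAt
  · filter_upwards [hkf, h] with r hr hr'
    rw [← hr', hr]
  · rw [← hx]
    have hkt : Filter.Tendsto k (𝓝 (f x)) (𝓝 x) := by
      have := hk.contMDiffAt.continuousAt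
      rwa [ContinuousAt, hkx] at this
    filter_upwards [hfk, hkt.eventually h] with y hy hy'
    rw [← hy', hy]

/-- Near the point `x`, the map `f` takes the family `E` of tangent subspaces to `E'`. -/
def Carries (f : M → N) (E : TangentFamily I M) (E' : TangentFamily J N) (x : M) : Prop :=
  ∀ᶠ r in 𝓝 x, (E r).map (mfderiv I J f r).toLinearMap = E' (f r)

/-- All tangent spaces are definitionally the model space `V`, so values at equal points can be
compared there without a cast. -/
theorem TangentFamily.apply_congr (E : TangentFamily I M) {x y : M} (h : x = y) :
    (show Submodule ℝ V from E x) = E y := by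
  subst h
  rfl

namespace Carries

variable {E : TangentFamily I M} {E' : TangentFamily J N} {E'' : TangentFamily K P}
  {f : M → N} {x : M}

theorem congr {g : M → N} (hE : Carries f E E' x) (h : f =ᶠ[𝓝 x] g) : Carries g E E' x := by
  filter_upwards [hE, h.eventuallyEq_nhds] with r hr hr'
  have h1 : (show V →L[ℝ] W from mfderiv I J g r) = mfderiv I J f r := hr'.symm.mfderiv_eq
  have h2 := E'.apply_congr hr'.self_of_nhds
  exact (congrArg (fun A : V →L[ℝ] W => (show Submodule ℝ V from E r).map A.toLinearMap) h1).trans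
    (hr.trans h2)

theorem comp {g : N → P} (hE : Carries f E E' x) (hE' : Carries g E' E'' (f x))
    (hf : IsLocalDiffeomorphAt I J ∞ f x) (hg : IsLocalDiffeomorphAt J K ∞ g (f x)) :
    Carries (g ∘ f) E E'' x := by
  have hft := hf.contMDiffAt.continuousAt
  filter_upwards [hE, hft.eventually hE', hf.eventually_mdifferentiableAt,
    hft.eventually hg.eventually_mdifferentiableAt] with r h1 h2 h3 h4
  rw [mfderiv_comp r h4 h3]
  refine (Submodule.map_comp _ _ _).trans ?_
  exact (congrArg _ h1).trans h2

theorem inverse {g : N → M} (hE : Carries f E E' x) (hf : IsLocalDiffeomorphAt I J ∞ f x)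
    (hg : IsLocalDiffeomorphAt J I ∞ g (f x)) (hgx : g (f x) = x)
    (hgf : ∀ᶠ r in 𝓝 x, g (f r) = r) (hfg : ∀ᶠ y in 𝓝 (f x), f (g y) = y) :
    Carries g E' E (f x) := by
  have hgt : Filter.Tendsto g (𝓝 (f x)) (𝓝 x) := by
    have := hg.contMDiffAt.continuousAt
    rwa [ContinuousAt, hgx] at this
  filter_upwards [hgt.eventually hE, hgt.eventually hf.eventually_mdifferentiableAt,
    hg.eventually_mdifferentiableAt, hgt.eventually hgf.eventually_nhds, hfg]
    with y h1 h2 h3 h4 h5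
  have h6 : (show Submodule ℝ W from E' y) = E' (f (g y)) := E'.apply_congr h5.symm
  have h7 : MDifferentiableAt J I g (f (g y)) := by rwa [h5]
  -- Differentiating `g ∘ f = id` shows that the differential of `g` undoes that of `f`.
  have h8 : mfderiv I I (g ∘ f) (g y) = mfderiv I I id (g y) :=
    Filter.EventuallyEq.mfderiv_eq h4
  rw [mfderiv_comp (g y) h7 h2, mfderiv_id] at h8
  have h9 : (show W →L[ℝ] V from mfderiv J I g y) = mfderiv J I g (f (g y)) := by rw [h5]
  have h10 : (E' (f (g y))).map (mfderiv J I g (f (g y))).toLinearMap = E (g y) := by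
    rw [← h1]
    refine (Submodule.map_comp _ _ _).symm.trans ?_
    refine (congrArg (fun A : V →L[ℝ] V => (show Submodule ℝ V from E (g y)).map A.toLinearMap)
      h8).trans ?_
    exact Submodule.map_id _
  refine Eq.trans ?_ h10
  exact congrArg₂ (fun (A : W →L[ℝ] V) (S : Submodule ℝ W) => S.map A.toLinearMap) h9 h6

theorem sup {E₂ : TangentFamily I M} {E₂' : TangentFamily J N} (h : Carries f E E' x)
    (h₂ : Carries f E₂ E₂' x) :
    Carries f (fun r => E r ⊔ E₂ r) (fun r => E' r ⊔ E₂' r) x := by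
  filter_upwards [h, h₂] with r hr hr'
  rw [Submodule.map_sup, hr, hr']

end Carries

end LocalDiffeomorphism

/-! ## First integrals of a vector field -/

/-- A map which is smooth near a point coincides near that point with a smooth map. -/
theorem exists_contDiff_eventuallyEq {E F : Type*} [NormedAddCommGroup E] [NormedSpace ℝ E]
    [HasContDiffBump E] [FiniteDimensional ℝ E] [NormedAddCommGroup F] [NormedSpace ℝ F] {f : E → F}
    {a : E} (hf : ∀ᶠ x in 𝓝 a, ContDiffAt ℝ ∞ f x) :
    ∃ g : E → F, ContDiff ℝ ∞ g ∧ g =ᶠ[𝓝 a] f := by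
  obtain ⟨ε, hε, hball⟩ := Metric.eventually_nhds_iff_ball.1 hf
  let b : ContDiffBump a := ⟨ε / 4, ε / 2, by positivity, by linarith⟩
  refine ⟨fun x => b x • f x, ?_, ?_⟩
  · rw [contDiff_iff_contDiffAt]
    intro x
    by_cases hx : x ∈ Metric.ball a ε
    · exact b.contDiff.contDiffAt.smul (hball x hx)
    · have h0 : (fun x => b x • f x) =ᶠ[𝓝 x] fun _ => 0 := by
        have hx' : x ∈ (Metric.closedBall a (ε / 2))ᶜ := by
          simp only [Metric.mem_ball, not_lt, Set.mem_compl_iff, Metric.mem_closedBall] at hx ⊢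
          linarith
        filter_upwards [Metric.isClosed_closedBall.isOpen_compl.mem_nhds hx'] with y hy
        rw [b.zero_of_le_dist, zero_smul]
        simp only [Set.mem_compl_iff, Metric.mem_closedBall, not_le] at hy
        exact hy.le
      exact contDiffAt_const.congr_of_eventuallyEq h0
  · filter_upwards [b.eventuallyEq_one] with x hx
    simp only [hx, Pi.one_apply, one_smul]

/-- A smooth vector field which does not vanish at `p` has two independent first integrals
near `p`, with prescribed differentials at `p`. -/
theorem exists_firstIntegrals {X : Space → Space} {p : Space}
    (hX : ∀ᶠ r in 𝓝 p, ContDiffAt ℝ ∞ X r) (A : Space ≃L[ℝ] ℝ × Plane) (hA : A (X p) = (1, 0)) :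
    ∃ ψ : Space → Plane, (∀ᶠ r in 𝓝 p, ContDiffAt ℝ ∞ ψ r ∧ fderiv ℝ ψ r (X r) = 0) ∧
      fderiv ℝ ψ p = (ContinuousLinearMap.snd ℝ ℝ Plane).comp (A : Space →L[ℝ] ℝ × Plane) := by
  -- The flow is constructed for globally smooth fields only, so `X` is first replaced by a global
  -- field with the same germ.
  obtain ⟨Y, hY, hYX⟩ := exists_contDiff_eventuallyEq hX
  obtain ⟨Φ, hΦ, hΦ0⟩ := exists_smooth_localFlow hY p
  have hΦp : Φ (0, p) = p := hΦ0.self_of_nhds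
  have hΦd : DifferentiableAt ℝ Φ (0, p) := hΦ.self_of_nhds.1.differentiableAt (by simp)
  -- Flow box: the first coordinate of `A ξ` is the time, and the other two choose a starting point
  -- on a transversal to `X p`. The map `B = Φ ∘ c` has identity derivative at `0`, and `ψ` reads
  -- off the starting point.
  let c : Space → ℝ × Space := fun ξ => ((A ξ).1, p + A.symm (0, (A ξ).2))
  have hc : ContDiff ℝ ∞ c := by
    refine (contDiff_fst.comp A.contDiff).prodMk (contDiff_const.add (A.symm.contDiff.comp ?_))
    exact contDiff_const.prodMk (contDiff_snd.comp A.contDiff)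
  have hc0 : c 0 = (0, p) := by simp [c]
  let c' : Space →L[ℝ] ℝ × Space :=
    ((ContinuousLinearMap.fst ℝ ℝ Plane).comp (A : Space →L[ℝ] ℝ × Plane)).prod
      ((A.symm : ℝ × Plane →L[ℝ] Space).comp (((0 : Space →L[ℝ] ℝ)).prod
        ((ContinuousLinearMap.snd ℝ ℝ Plane).comp (A : Space →L[ℝ] ℝ × Plane))))
  have hcd : HasFDerivAt c c' 0 := by
    have : c = fun ξ => (0, p) + c' ξ := by
      ext ξ <;> simp [c, c']
    rw [this]
    exact c'.hasFDerivAt.const_add _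
  let B : Space → Space := fun ξ => Φ (c ξ)
  have hB : ∀ᶠ ξ in 𝓝 0, ContDiffAt ℝ ∞ B ξ := by
    have h := hc.continuous.tendsto 0
    rw [hc0] at h
    filter_upwards [h.eventually hΦ] with ξ hξ
    exact hξ.1.comp ξ hc.contDiffAt
  have hΦt : fderiv ℝ Φ (0, p) (1, 0) = X p := by
    have h1 : HasDerivAt (fun t : ℝ => (t, p)) ((1 : ℝ), (0 : Space)) 0 :=
      (hasDerivAt_id 0).prodMk (hasDerivAt_const _ _)
    have h2 := (hΦd.hasFDerivAt.comp_hasDerivAt (0 : ℝ) h1).unique hΦ.self_of_nhds.2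
    rw [h2, hΦp, hYX.self_of_nhds]
  have hΦx : ∀ v, fderiv ℝ Φ (0, p) (0, v) = v := by
    intro v
    have h1 : HasFDerivAt (fun x : Space => ((0 : ℝ), x))
        ((0 : Space →L[ℝ] ℝ).prod (ContinuousLinearMap.id ℝ Space)) p :=
      (hasFDerivAt_const _ _).prodMk (hasFDerivAt_id _)
    have h2 := (HasFDerivAt.comp p hΦd.hasFDerivAt h1).unique
      ((hasFDerivAt_id p).congr_of_eventuallyEq hΦ0)
    simpa using DFunLike.congr_fun h2 v
  have hBd : HasFDerivAt B ((ContinuousLinearEquiv.refl ℝ Space : Space ≃L[ℝ] Space) :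
      Space →L[ℝ] Space) 0 := by
    have h1 : HasFDerivAt Φ (fderiv ℝ Φ (0, p)) (c 0) := by
      rw [hc0]
      exact hΦd.hasFDerivAt
    refine (HasFDerivAt.comp 0 h1 hcd).congr_fderiv ?_
    apply ContinuousLinearMap.ext
    intro ξ
    change fderiv ℝ Φ (0, p) ((A ξ).1, A.symm (0, (A ξ).2)) = ξ
    have h2 : (((A ξ).1, A.symm (0, (A ξ).2)) : ℝ × Space) =
        (A ξ).1 • ((1 : ℝ), (0 : Space)) + (0, A.symm (0, (A ξ).2)) := by simp
    rw [h2, map_add, map_smul, hΦt, hΦx]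
    apply A.injective
    rw [map_add, map_smul, hA, A.apply_symm_apply]
    ext <;> simp
  have hB0 : B 0 = p := by simp only [B, hc0, hΦp]
  obtain ⟨g, hgB, hg0, hgs⟩ := exists_smooth_localInverse hB hBd
  rw [hB0] at hgs
  have hgp : g.symm p = 0 := by
    rw [← hB0, ← hgB]
    exact g.left_inv hg0
  have hpt : p ∈ g.target := by
    rw [← hB0, ← hgB]
    exact g.map_source hg0
  let ψ : Space → Plane := fun r => (A (g.symm r)).2
  have hψ : ∀ᶠ r in 𝓝 p, ContDiffAt ℝ ∞ ψ r := by
    filter_upwards [hgs] with r hr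
    exact contDiff_snd.contDiffAt.comp r (A.contDiff.contDiffAt.comp r hr)
  refine ⟨ψ, hψ.and ?_, ?_⟩
  · have hgt : Filter.Tendsto g.symm (𝓝 p) (𝓝 0) := by
      have := g.continuousAt_symm hpt
      rwa [ContinuousAt, hgp] at this
    have hct := (hc.continuous.tendsto 0).comp hgt
    rw [hc0] at hct
    filter_upwards [hψ, g.open_target.mem_nhds hpt, hct.eventually hΦ, hYX]
      with r hr hrt hrΦ hrY
    have hrB : Φ (c (g.symm r)) = r := by
      change B (g.symm r) = r
      rw [← hgB]
      exact g.right_inv hrt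
    have hψr : DifferentiableAt ℝ ψ r := hr.differentiableAt (by simp)
    have h1 : HasDerivAt (fun t => Φ (t, (c (g.symm r)).2)) (X r) (c (g.symm r)).1 := by
      have := hrΦ.2
      rwa [Function.comp_apply, hrB, hrY] at this
    have h2 : HasFDerivAt ψ (fderiv ℝ ψ r)
        (Φ ((c (g.symm r)).1, (c (g.symm r)).2)) := by
      rw [Prod.mk.eta, hrB]
      exact hψr.hasFDerivAt
    have h3 := h2.comp_hasDerivAt _ h1
    have hline : Filter.Tendsto (fun t : ℝ => A.symm (t, (A (g.symm r)).2))
        (𝓝 (A (g.symm r)).1) (𝓝 (g.symm r)) := by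
      have : Continuous fun t : ℝ => A.symm (t, (A (g.symm r)).2) := by fun_prop
      have h4 := this.tendsto (A (g.symm r)).1
      rwa [Prod.mk.eta, A.symm_apply_apply] at h4
    -- Moving along the trajectory changes only the time coordinate of the flow box, so `ψ` is
    -- constant there.
    have h5 : (ψ ∘ fun t => Φ (t, (c (g.symm r)).2)) =ᶠ[𝓝 (c (g.symm r)).1]
        fun _ => (A (g.symm r)).2 := by
      filter_upwards [hline.eventually (g.open_source.mem_nhds (g.map_target hrt))] with t ht
      have h6 : Φ (t, (c (g.symm r)).2) = g (A.symm (t, (A (g.symm r)).2)) := by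
        rw [hgB]
        simp [B, c]
      rw [Function.comp_apply, h6]
      simp only [ψ]
      rw [g.left_inv ht, A.apply_symm_apply]
    exact h3.unique ((hasDerivAt_const _ _).congr_of_eventuallyEq h5)
  · have h1 : HasFDerivAt g.symm ((ContinuousLinearEquiv.refl ℝ Space).symm :
        Space →L[ℝ] Space) p := by
      refine g.hasFDerivAt_symm hpt ?_
      rw [hgp, hgB]
      exact hBd
    have h2 : HasFDerivAt ψ (((ContinuousLinearMap.snd ℝ ℝ Plane).comp
        (A : Space →L[ℝ] ℝ × Plane)).comp ((ContinuousLinearEquiv.refl ℝ Space).symm :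
        Space →L[ℝ] Space)) p :=
      ((ContinuousLinearMap.snd ℝ ℝ Plane).comp
        (A : Space →L[ℝ] ℝ × Plane)).hasFDerivAt.comp p h1
    rw [h2.fderiv]
    rfl

/-! ## The smooth structure of the space of directions -/

namespace PlaneDirection

/-- The chart `slopeChart` as an open partial homeomorphism. -/
noncomputable def slopeHomeomorph : OpenPartialHomeomorph PlaneDirection ℝ :=
  core.openPartialHomeomorph slopeChart (by simp [core])

/-- The chart `coslopeChart` as an open partial homeomorphism. -/
noncomputable def coslopeHomeomorph : OpenPartialHomeomorph PlaneDirection ℝ :=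
  core.openPartialHomeomorph coslopeChart (by simp [core])

theorem slopeHomeomorph_mem_maximalAtlas :
    slopeHomeomorph ∈ IsManifold.maximalAtlas 𝓘(ℝ, ℝ) ∞ PlaneDirection := by
  apply IsManifold.subset_maximalAtlas
  exact Set.mem_iUnion₂.2 ⟨slopeChart, by simp [core], rfl⟩

theorem coslopeHomeomorph_mem_maximalAtlas :
    coslopeHomeomorph ∈ IsManifold.maximalAtlas 𝓘(ℝ, ℝ) ∞ PlaneDirection := by
  apply IsManifold.subset_maximalAtlas
  exact Set.mem_iUnion₂.2 ⟨coslopeChart, by simp [core], rfl⟩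

theorem contMDiff_ofSlope : ContMDiff 𝓘(ℝ, ℝ) 𝓘(ℝ, ℝ) ∞ ofSlope := fun z =>
  (contMDiffOn_symm_of_mem_maximalAtlas slopeHomeomorph_mem_maximalAtlas).contMDiffAt
    (slopeHomeomorph.open_target.mem_nhds (Set.mem_univ z))

theorem contMDiff_ofCoslope : ContMDiff 𝓘(ℝ, ℝ) 𝓘(ℝ, ℝ) ∞ ofCoslope := fun z =>
  (contMDiffOn_symm_of_mem_maximalAtlas coslopeHomeomorph_mem_maximalAtlas).contMDiffAt
    (coslopeHomeomorph.open_target.mem_nhds (Set.mem_univ z))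

theorem isOpen_ne_vertical : IsOpen {l : PlaneDirection | l ≠ ofCoslope 0} :=
  slopeHomeomorph.open_source

theorem isOpen_ne_horizontal : IsOpen {l : PlaneDirection | l ≠ ofSlope 0} :=
  coslopeHomeomorph.open_source

theorem contMDiffAt_slope {l : PlaneDirection} (hl : l ≠ ofCoslope 0) :
    ContMDiffAt 𝓘(ℝ, ℝ) 𝓘(ℝ, ℝ) ∞ slope l :=
  (contMDiffOn_of_mem_maximalAtlas slopeHomeomorph_mem_maximalAtlas).contMDiffAt
    (slopeHomeomorph.open_source.mem_nhds hl)

theorem contMDiffAt_coslope {l : PlaneDirection} (hl : l ≠ ofSlope 0) :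
    ContMDiffAt 𝓘(ℝ, ℝ) 𝓘(ℝ, ℝ) ∞ coslope l :=
  (contMDiffOn_of_mem_maximalAtlas coslopeHomeomorph_mem_maximalAtlas).contMDiffAt
    (coslopeHomeomorph.open_source.mem_nhds hl)

open Classical in
/-- The direction of a nonzero vector of the plane (and a fixed direction for the vector `0`). -/
noncomputable def ofVector (v : Plane) : PlaneDirection :=
  if hv : v ≠ 0 then Projectivization.mk ℝ v hv else ofSlope 0

theorem ofVector_of_ne {v : Plane} (hv : v ≠ 0) : ofVector v = Projectivization.mk ℝ v hv :=
  dif_pos hv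

theorem submodule_ofVector {v : Plane} (hv : v ≠ 0) :
    (ofVector v).submodule = Submodule.span ℝ {v} := by
  rw [ofVector_of_ne hv, Projectivization.submodule_mk]

theorem ofVector_smul {v : Plane} (hv : v ≠ 0) {c : ℝ} (hc : c ≠ 0) :
    ofVector (c • v) = ofVector v := by
  rw [ofVector_of_ne hv, ofVector_of_ne (smul_ne_zero hc hv)]
  exact (Projectivization.mk_eq_mk_iff' ℝ _ _ _ _).2 ⟨c, rfl⟩

theorem ofVector_slope_pair (z : ℝ) : ofVector (1, z) = ofSlope z := ofVector_of_ne _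

theorem ofVector_coslope_pair (z : ℝ) : ofVector (z, 1) = ofCoslope z := ofVector_of_ne _

theorem ofVector_eq_ofSlope {v : Plane} (hv : v.1 ≠ 0) : ofVector v = ofSlope (v.2 / v.1) := by
  have h : v = v.1 • ((1, v.2 / v.1) : Plane) := by
    ext
    · simp
    · simp [mul_div_cancel₀ _ hv]
  conv_lhs => rw [h, ofVector_smul (by simp) hv, ofVector_slope_pair]

theorem ofVector_eq_ofCoslope {v : Plane} (hv : v.2 ≠ 0) :
    ofVector v = ofCoslope (v.1 / v.2) := by
  have h : v = v.2 • ((v.1 / v.2, 1) : Plane) := by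
    ext
    · simp [mul_div_cancel₀ _ hv]
    · simp
  conv_lhs => rw [h, ofVector_smul (by simp) hv, ofVector_coslope_pair]

theorem contMDiffAt_ofVector {v : Plane} (hv : v ≠ 0) :
    ContMDiffAt 𝓘(ℝ, Plane) 𝓘(ℝ, ℝ) ∞ ofVector v := by
  by_cases h1 : v.1 = 0
  · have h2 : v.2 ≠ 0 := fun h2 => hv (Prod.ext h1 h2)
    have h3 : ContDiffAt ℝ ∞ (fun w : Plane => w.1 / w.2) v :=
      contDiffAt_fst.div contDiffAt_snd h2
    refine ((contMDiff_ofCoslope _).comp v h3.contMDiffAt).congr_of_eventuallyEq ?_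
    filter_upwards [continuous_snd.continuousAt.eventually_ne h2] with w hw
    exact ofVector_eq_ofCoslope hw
  · have h3 : ContDiffAt ℝ ∞ (fun w : Plane => w.2 / w.1) v :=
      contDiffAt_snd.div contDiffAt_fst h1
    refine ((contMDiff_ofSlope _).comp v h3.contMDiffAt).congr_of_eventuallyEq ?_
    filter_upwards [continuous_fst.continuousAt.eventually_ne h1] with w hw
    exact ofVector_eq_ofSlope hw

/-- Near every direction there is a smooth choice of a nonzero vector of that direction. -/
theorem exists_section (l₀ : PlaneDirection) :
    ∃ s : PlaneDirection → Plane, ∀ᶠ l in 𝓝 l₀, ContMDiffAt 𝓘(ℝ, ℝ) 𝓘(ℝ, Plane) ∞ s l ∧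
      s l ≠ 0 ∧ ofVector (s l) = l := by
  by_cases h : l₀ = ofCoslope 0
  · have h' : l₀ ≠ ofSlope 0 := by
      rw [h]
      exact ofCoslope_ne 0
    refine ⟨fun l => (coslope l, 1), ?_⟩
    filter_upwards [isOpen_ne_horizontal.mem_nhds h'] with l hl
    refine ⟨(contMDiffAt_coslope hl).prodMk_space contMDiffAt_const, by simp, ?_⟩
    rw [ofVector_coslope_pair, ofCoslope_coslope hl]
  · refine ⟨fun l => (1, slope l), ?_⟩
    filter_upwards [isOpen_ne_vertical.mem_nhds h] with l hl
    refine ⟨contMDiffAt_const.prodMk_space (contMDiffAt_slope hl), by simp, ?_⟩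
    rw [ofVector_slope_pair, ofSlope_slope hl]

end PlaneDirection

open PlaneDirection

/-! ## Coordinates on the space of first jets -/

/-- The inverse of the chart `(x, y, z₁)`. -/
noncomputable def J1.ofCoords (u : Plane × ℝ) : J1 := (u.1, ofSlope u.2)

theorem J1.isLocalDiffeomorphAt_ofCoords (u : Plane × ℝ) :
    IsLocalDiffeomorphAt 𝓘(ℝ, Plane × ℝ) J1Model ∞ J1.ofCoords u := by
  refine isLocalDiffeomorphAt_of_inverse (g := fun q : J1 => (q.1, slope q.2)) ?_ ?_ ?_ ?_
  · refine Filter.Eventually.of_forall fun v => ?_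
    exact contDiff_fst.contMDiff.contMDiffAt.prodMk
      ((contMDiff_ofSlope _).comp v contDiff_snd.contMDiff.contMDiffAt)
  · have h : {l : PlaneDirection | l ≠ ofCoslope 0} ∈ 𝓝 (J1.ofCoords u).2 :=
      isOpen_ne_vertical.mem_nhds (ofSlope_ne _)
    filter_upwards [continuous_snd.continuousAt.preimage_mem_nhds h] with q hq
    exact contMDiffAt_fst.prodMk_space ((contMDiffAt_slope hq).comp q contMDiffAt_snd)
  · exact Filter.Eventually.of_forall fun v => by simp [J1.ofCoords]
  · have h : {l : PlaneDirection | l ≠ ofCoslope 0} ∈ 𝓝 (J1.ofCoords u).2 :=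
      isOpen_ne_vertical.mem_nhds (ofSlope_ne _)
    filter_upwards [continuous_snd.continuousAt.preimage_mem_nhds h] with q hq
    exact Prod.ext rfl (ofSlope_slope hq)

theorem J1.mfderiv_proj_apply (q : J1) (ξ : Plane × ℝ) :
    mfderiv J1Model 𝓘(ℝ, Plane) J1.proj q ξ = ξ.1 := by
  have h : mfderiv J1Model 𝓘(ℝ, Plane) J1.proj q =
      ContinuousLinearMap.fst ℝ (TangentSpace 𝓘(ℝ, Plane) q.1) (TangentSpace 𝓘(ℝ, ℝ) q.2) :=
    mfderiv_fst
  rw [h]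
  rfl

theorem mem_verticalField {q : J1} {ξ : Plane × ℝ} :
    (show TangentSpace J1Model q from ξ) ∈ verticalField q ↔ ξ.1 = 0 := by
  rw [verticalField, LinearMap.mem_ker, ← J1.mfderiv_proj_apply q ξ]
  rfl

theorem mem_contactDistribution {q : J1} {ξ : Plane × ℝ} :
    (show TangentSpace J1Model q from ξ) ∈ contactDistribution q ↔ ξ.1 ∈ q.2.submodule := by
  rw [contactDistribution, Submodule.mem_comap, ← J1.mfderiv_proj_apply q ξ]
  rfl

theorem J1.mfderiv_apply_fst {V H : Type*} [NormedAddCommGroup V] [NormedSpace ℝ V]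
    [TopologicalSpace H] {I : ModelWithCorners ℝ V H} {M : Type*} [TopologicalSpace M]
    [ChartedSpace H M] {f : M → J1} {x : M} (hf : MDifferentiableAt I J1Model f x)
    (ξ : TangentSpace I x) :
    (show Plane × ℝ from mfderiv I J1Model f x ξ).1 =
      mfderiv I 𝓘(ℝ, Plane) (fun r => (f r).1) x ξ := by
  have h : mfderiv I 𝓘(ℝ, Plane) (J1.proj ∘ f) x =
      (mfderiv J1Model 𝓘(ℝ, Plane) J1.proj (f x)).comp (mfderiv I J1Model f x) :=
    mfderiv_comp x mdifferentiableAt_fst hf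
  change _ = mfderiv I 𝓘(ℝ, Plane) (J1.proj ∘ f) x ξ
  rw [h]
  exact (J1.mfderiv_proj_apply _ _).symm

/-! ## Nondegenerate pairs of direction fields -/

theorem GeneratesAt.eventually_contDiffAt {X : ∀ r : Space, TangentSpace 𝓘(ℝ, Space) r}
    {E : SpaceFamily} {p : Space} (h : GeneratesAt 𝓘(ℝ, Space) X E p) :
    ∀ᶠ r in 𝓝 p, ContDiffAt ℝ ∞ (fun r => (X r : Space)) r :=
  h.mono fun _ hr => contMDiffAt_vectorSpace_iff_contDiffAt.1 hr.1

/-- Three vectors of the space, the second of which is not proportional to the first and the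
third of which does not lie in the plane of the first two, form a basis. -/
theorem exists_coordinates {x y w : Space} (hx : x ≠ 0)
    (hy : y ∉ Submodule.span ℝ {x}) (hw : w ∉ Submodule.span ℝ {x} ⊔ Submodule.span ℝ {y}) :
    ∃ A : Space ≃L[ℝ] ℝ × Plane, A x = (1, 0) ∧ A y = (0, (1, 0)) ∧ A w = (0, (0, 1)) := by
  let T : ℝ × Plane →ₗ[ℝ] Space :=
    { toFun := fun u => u.1 • x + u.2.1 • y + u.2.2 • w
      map_add' := fun u v => by simp only [Prod.fst_add, Prod.snd_add, add_smul]; abel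
      map_smul' := fun c u => by
        simp only [Prod.smul_fst, Prod.smul_snd, smul_eq_mul, mul_smul, smul_add,
          RingHom.id_apply] }
  have hT : ∀ u, T u = u.1 • x + u.2.1 • y + u.2.2 • w := fun u => rfl
  have hinj : Function.Injective T := by
    rw [injective_iff_map_eq_zero]
    rintro ⟨a, b, c⟩ h
    rw [hT] at h
    simp only at h
    have hc : c = 0 := by
      by_contra hc
      apply hw
      have hw' : w = (-(c⁻¹ * a)) • x + (-(c⁻¹ * b)) • y := by
        have h1 : c⁻¹ • (a • x + b • y + c • w) = 0 := by rw [h, smul_zero]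
        rw [smul_add, smul_smul, inv_mul_cancel₀ hc, one_smul] at h1
        rw [eq_neg_of_add_eq_zero_right h1, smul_add, smul_smul, smul_smul, neg_add, neg_smul,
          neg_smul]
      rw [hw']
      exact Submodule.add_mem_sup
        (Submodule.smul_mem _ _ (Submodule.mem_span_singleton_self x))
        (Submodule.smul_mem _ _ (Submodule.mem_span_singleton_self y))
    subst hc
    rw [zero_smul, add_zero] at h
    have hb : b = 0 := by
      by_contra hb
      apply hy
      refine Submodule.mem_span_singleton.2 ⟨-(b⁻¹ * a), ?_⟩
      have h1 : b⁻¹ • (a • x + b • y) = 0 := by rw [h, smul_zero]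
      rw [smul_add, smul_smul, smul_smul, inv_mul_cancel₀ hb, one_smul] at h1
      rw [eq_neg_of_add_eq_zero_right h1, neg_smul]
    subst hb
    rw [zero_smul, add_zero] at h
    have ha : a = 0 := (smul_eq_zero.1 h).resolve_right hx
    rw [ha]
    rfl
  let e : (ℝ × Plane) ≃L[ℝ] Space := (LinearEquiv.ofInjectiveEndo T hinj).toContinuousLinearEquiv
  have he : ∀ u, e u = T u := fun u => rfl
  refine ⟨e.symm, ?_, ?_, ?_⟩ <;> rw [ContinuousLinearEquiv.symm_apply_eq, he, hT] <;> simp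

/-- Generators of a nondegenerate pair, with coordinates adapted to them and their bracket. -/
theorem IsNondegeneratePairAt.exists_generators {E₁ E₂ : SpaceFamily} {p : Space}
    (h : IsNondegeneratePairAt E₁ E₂ p) :
    ∃ X₁ X₂ : Space → Space, ∃ A : Space ≃L[ℝ] ℝ × Plane,
      GeneratesAt 𝓘(ℝ, Space) X₁ E₁ p ∧ GeneratesAt 𝓘(ℝ, Space) X₂ E₂ p ∧
      A (X₁ p) = (1, 0) ∧ A (X₂ p) = (0, (1, 0)) ∧
      A (fderiv ℝ X₂ p (X₁ p) - fderiv ℝ X₁ p (X₂ p)) = (0, (0, 1)) := by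
  obtain ⟨hne, X₁, X₂, h₁, h₂, hb⟩ := h
  have hE₁ := h₁.self_of_nhds
  have hE₂ := h₂.self_of_nhds
  have hb' : fderiv ℝ (X₂ : Space → Space) p (X₁ p) - fderiv ℝ (X₁ : Space → Space) p (X₂ p) ∉
      Submodule.span ℝ {(X₁ p : Space)} ⊔ Submodule.span ℝ {(X₂ p : Space)} := by
    have hbr : VectorField.mlieBracket 𝓘(ℝ, Space) X₁ X₂ p =
        VectorField.lieBracket ℝ (X₁ : Space → Space) (X₂ : Space → Space) p := by
      rw [← VectorField.mlieBracketWithin_univ, VectorField.mlieBracketWithin_eq_lieBracketWithin]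
      exact congrFun VectorField.lieBracketWithin_univ p
    rw [hbr, hE₁.2.2, hE₂.2.2] at hb
    exact hb
  have hy : (X₂ p : Space) ∉ Submodule.span ℝ {(X₁ p : Space)} := by
    intro hy
    apply hne
    rw [hE₁.2.2, hE₂.2.2]
    obtain ⟨c, hc⟩ := Submodule.mem_span_singleton.1 hy
    have hc0 : IsUnit c := by
      rw [isUnit_iff_ne_zero]
      rintro rfl
      rw [zero_smul] at hc
      exact hE₂.2.1 hc.symm
    have := Submodule.span_singleton_smul_eq hc0 (X₁ p : Space)
    rw [hc] at this
    exact this.symm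
  obtain ⟨A, hA₁, hA₂, hA₃⟩ := exists_coordinates (x := X₁ p) (y := X₂ p) hE₁.2.1 hy hb'
  exact ⟨X₁, X₂, A, h₁, h₂, hA₁, hA₂, hA₃⟩

theorem Submodule.map_eq_span_singleton {R V W : Type*} [Semiring R] [AddCommMonoid V] [Module R V]
    [AddCommMonoid W] [Module R W] {S : Submodule R V} {x : V} (h : S = Submodule.span R {x})
    (f : V →ₗ[R] W) : S.map f = Submodule.span R {f x} := by
  rw [h, Submodule.map_span, Set.image_singleton]

theorem verticalField_eq_span {q : J1} {ξ : Plane × ℝ} (h1 : ξ.1 = 0) (hξ : ξ ≠ 0) :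
    Submodule.span ℝ {(show TangentSpace J1Model q from ξ)} = verticalField q := by
  have h2 : ξ.2 ≠ 0 := fun h2 => hξ (Prod.ext h1 h2)
  apply le_antisymm
  · rw [Submodule.span_singleton_le_iff_mem]
    exact mem_verticalField.2 h1
  · intro η hη
    have hη' : (show Plane × ℝ from η).1 = 0 := mem_verticalField.1 hη
    refine Submodule.mem_span_singleton.2 ⟨(show Plane × ℝ from η).2 / ξ.2, ?_⟩
    refine Prod.ext (?_ : _ • ξ.1 = (show Plane × ℝ from η).1)
      (?_ : _ • ξ.2 = (show Plane × ℝ from η).2)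
    · rw [h1, hη', smul_zero]
    · rw [smul_eq_mul, div_mul_cancel₀ _ h2]

/-- The projection of a contact vector is a multiple of `η.1`, so subtracting that multiple of `η`
leaves a vertical vector. -/
theorem contactDistribution_eq_span {q : J1} {η : Plane × ℝ} (h0 : η.1 ≠ 0)
    (h1 : η.1 ∈ q.2.submodule) :
    verticalField q ⊔ Submodule.span ℝ {(show TangentSpace J1Model q from η)} =
      contactDistribution q := by
  apply le_antisymm
  · refine sup_le ?_ ?_
    · intro ζ hζ
      refine mem_contactDistribution.2 ?_
      rw [mem_verticalField.1 hζ]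
      exact Submodule.zero_mem _
    · rw [Submodule.span_singleton_le_iff_mem]
      exact mem_contactDistribution.2 h1
  · intro ζ hζ
    have hζ' := mem_contactDistribution.1 hζ
    have hq : ∃ c : ℝ, c • η.1 = (show Plane × ℝ from ζ).1 := by
      rw [Projectivization.submodule_eq] at h1 hζ'
      obtain ⟨a, ha⟩ := Submodule.mem_span_singleton.1 h1
      obtain ⟨b, hb⟩ := Submodule.mem_span_singleton.1 hζ'
      have ha0 : a ≠ 0 := by
        rintro rfl
        rw [zero_smul] at ha
        exact h0 ha.symm
      refine ⟨b / a, ?_⟩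
      rw [← ha, smul_smul, div_mul_cancel₀ _ ha0]
      exact hb
    obtain ⟨c, hc⟩ := hq
    have h2 : ζ = (show TangentSpace J1Model q from
        (show Plane × ℝ from ζ) - c • η) + c • (show TangentSpace J1Model q from η) :=
      (sub_add_cancel _ _).symm
    rw [h2]
    refine Submodule.add_mem_sup ?_
      (Submodule.smul_mem _ _ (Submodule.mem_span_singleton_self _))
    refine mem_verticalField.2 ?_
    rw [Prod.fst_sub, Prod.smul_fst, hc, sub_self]

/-- Coordinates of the space in which a nondegenerate pair becomes the pair of the vertical field
and a field of the contact distribution. -/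
theorem exists_adaptedCoordinates {X₁ X₂ : Space → Space} {p : Space}
    (h₁ : ∀ᶠ r in 𝓝 p, ContDiffAt ℝ ∞ X₁ r) (h₂ : ∀ᶠ r in 𝓝 p, ContDiffAt ℝ ∞ X₂ r)
    (A : Space ≃L[ℝ] ℝ × Plane) (hA₁ : A (X₁ p) = (1, 0)) (hA₂ : A (X₂ p) = (0, (1, 0)))
    (hA : A (fderiv ℝ X₂ p (X₁ p) - fderiv ℝ X₁ p (X₂ p)) = (0, (0, 1))) :
    ∃ (ψ : Space → Plane) (z : Space → ℝ),
      IsLocalDiffeomorphAt 𝓘(ℝ, Space) 𝓘(ℝ, Plane × ℝ) ∞ (fun r => (ψ r, z r)) p ∧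
      ∀ᶠ r in 𝓝 p, fderiv ℝ ψ r (X₁ r) = 0 ∧ fderiv ℝ ψ r (X₂ r) ≠ 0 ∧
        ∃ c : ℝ, fderiv ℝ ψ r (X₂ r) = c • ((1, z r) : Plane) := by
  obtain ⟨ψ, hψ, hψp⟩ := exists_firstIntegrals h₁ A hA₁
  -- The projection of `X₂` to the plane of first integrals; its slope `z` will be the third
  -- coordinate. The prescribed differential of `ψ` gives `w p = (1, 0)`, so the slope is defined
  -- near `p`.
  let w : Space → Plane := fun r => fderiv ℝ ψ r (X₂ r)
  have hw : ∀ᶠ r in 𝓝 p, ContDiffAt ℝ ∞ w r := by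
    filter_upwards [hψ, h₂] with r hr hr2
    exact (hr.1.fderiv_right (m := ∞) (by simp)).clm_apply hr2
  have hwp : w p = (1, 0) := by
    simp only [w, hψp]
    rw [ContinuousLinearMap.comp_apply]
    exact congrArg Prod.snd hA₂
  have hw0 : ∀ᶠ r in 𝓝 p, (w r).1 ≠ 0 := by
    refine (continuous_fst.continuousAt.comp hw.self_of_nhds.continuousAt).eventually_ne ?_
    simp [hwp]
  let z : Space → ℝ := fun r => (w r).2 / (w r).1
  have hz : ∀ᶠ r in 𝓝 p, ContDiffAt ℝ ∞ z r := by
    filter_upwards [hw, hw0] with r hr hr0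
    exact (contDiffAt_snd.comp r hr).div (contDiffAt_fst.comp r hr) hr0
  have hψd : DifferentiableAt ℝ ψ p := hψ.self_of_nhds.1.differentiableAt (by simp)
  have hzd : DifferentiableAt ℝ z p := hz.self_of_nhds.differentiableAt (by simp)
  -- Differentiating `dψ(X₁) = 0` along `X₂` and `w = dψ(X₂)` along `X₁`, the second derivatives of
  -- `ψ` cancel by symmetry and leave `dw(X₁) = dψ([X₁, X₂]) = (0, 1)` at `p`. Since `w = (1, 0)`
  -- there, the slope has derivative `1`.
  have hzX : fderiv ℝ z p (X₁ p) = 1 := by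
    have hψ' : HasFDerivAt (fderiv ℝ ψ) (fderiv ℝ (fderiv ℝ ψ) p) p :=
      ((hψ.self_of_nhds.1.fderiv_right (m := ∞) (by simp)).differentiableAt
        (by simp)).hasFDerivAt
    have hX₁ : HasFDerivAt X₁ (fderiv ℝ X₁ p) p :=
      (h₁.self_of_nhds.differentiableAt (by simp)).hasFDerivAt
    have hX₂ : HasFDerivAt X₂ (fderiv ℝ X₂ p) p :=
      (h₂.self_of_nhds.differentiableAt (by simp)).hasFDerivAt
    have hd₁ := (hψ'.clm_apply hX₁).unique ((hasFDerivAt_const (0 : Plane) p).congr_of_eventuallyEq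
      (hψ.mono fun r hr => hr.2))
    have hd₂ : HasFDerivAt w _ p := hψ'.clm_apply hX₂
    have hsymm : fderiv ℝ (fderiv ℝ ψ) p (X₁ p) (X₂ p) =
        fderiv ℝ (fderiv ℝ ψ) p (X₂ p) (X₁ p) :=
      hψ.self_of_nhds.1.isSymmSndFDerivAt
        (by rw [minSmoothness_of_isRCLikeNormedField]; exact ENat.LEInfty.out) _ _
    have hwX : fderiv ℝ w p (X₁ p) = (0, 1) := by
      have e₁ := DFunLike.congr_fun hd₁ (X₂ p)
      have e₂ := congrArg Prod.snd hA
      have e₃ : fderiv ℝ ψ p (fderiv ℝ X₂ p (X₁ p) - fderiv ℝ X₁ p (X₂ p)) = (0, 1) := by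
        rw [hψp]
        exact e₂
      rw [map_sub] at e₃
      rw [hd₂.fderiv, ← e₃]
      simp only [add_apply, ContinuousLinearMap.comp_apply,
        ContinuousLinearMap.flip_apply, zero_apply] at e₁ ⊢
      rw [hsymm, eq_neg_of_add_eq_zero_right e₁]
      abel
    have hw2 : (fun r => z r * (w r).1) =ᶠ[𝓝 p] fun r => (w r).2 := by
      filter_upwards [hw0] with r hr
      exact div_mul_cancel₀ _ hr
    have hwd : HasFDerivAt w (fderiv ℝ w p) p :=
      (hw.self_of_nhds.differentiableAt (by simp)).hasFDerivAt
    have h3 := ((hzd.hasFDerivAt.mul hwd.fst).congr_of_eventuallyEq hw2.symm).unique hwd.snd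
    have h4 := DFunLike.congr_fun h3 (X₁ p)
    have hzp : z p = 0 := by simp [z, hwp]
    simpa [hwp, hwX, hzp] using h4
  -- The kernel of `dψ` at `p` is the line of `X₁ p`, and `dz` does not vanish on it.
  have hinj : Function.Injective ((fderiv ℝ ψ p).prod (fderiv ℝ z p)).toLinearMap := by
    rw [injective_iff_map_eq_zero]
    intro ξ hξ
    have hξ1 : fderiv ℝ ψ p ξ = 0 := congrArg Prod.fst hξ
    have hξ2 : fderiv ℝ z p ξ = 0 := congrArg Prod.snd hξ
    have h3 : A ξ = (A ξ).1 • A (X₁ p) := by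
      rw [hψp] at hξ1
      rw [hA₁]
      exact Prod.ext (by simp) (by rw [Prod.smul_snd, smul_zero]; exact hξ1)
    rw [← map_smul] at h3
    have h4 := A.injective h3
    rw [h4, map_smul, hzX, smul_eq_mul, mul_one] at hξ2
    rw [h4, hξ2, zero_smul]
  let e : Space ≃L[ℝ] Plane × ℝ :=
    (LinearEquiv.ofInjectiveOfFinrankEq _ hinj (by simp)).toContinuousLinearEquiv
  have hΘ : HasFDerivAt (fun r => (ψ r, z r)) (e : Space →L[ℝ] Plane × ℝ) p :=
    hψd.hasFDerivAt.prodMk hzd.hasFDerivAt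
  have hΘs : ∀ᶠ r in 𝓝 p, ContDiffAt ℝ ∞ (fun r => (ψ r, z r)) r := by
    filter_upwards [hψ, hz] with r hr hr2
    exact hr.1.prodMk hr2
  obtain ⟨g, hgΘ, hgp, hgs⟩ := exists_smooth_localInverse hΘs hΘ
  refine ⟨ψ, z, ?_, ?_⟩
  · refine isLocalDiffeomorphAt_of_inverse (g := g.symm) (hΘs.mono fun r hr => hr.contMDiffAt)
      (hgs.mono fun r hr => hr.contMDiffAt) ?_ ?_
    · simpa only [hgΘ] using g.eventually_left_inverse hgp
    · simpa only [hgΘ] using g.eventually_right_inverse' hgp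
  · filter_upwards [hψ, hw0] with r hr hr0
    refine ⟨hr.2, fun h => hr0 (congrArg Prod.fst h), (w r).1, ?_⟩
    change w r = _
    ext
    · simp
    · simp [z, mul_div_cancel₀ _ hr0]

/-- Every nondegenerate pair of direction fields has a corresponding field of directions on the
space of first jets. -/
theorem IsNondegeneratePairAt.exists_correspondsAt {E₁ E₂ : SpaceFamily} {p : Space}
    (h : IsNondegeneratePairAt E₁ E₂ p) :
    ∃ (E : J1Family) (q : J1), CorrespondsAt E₁ E₂ p E q := by
  obtain ⟨X₁, X₂, A, h₁, h₂, hA₁, hA₂, hA⟩ := h.exists_generators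
  obtain ⟨ψ, z, hΘ, hψ⟩ := exists_adaptedCoordinates h₁.eventually_contDiffAt
    h₂.eventually_contDiffAt A hA₁ hA₂ hA
  let Φ : Space → J1 := J1.ofCoords ∘ fun r => (ψ r, z r)
  have hΦ : IsLocalDiffeomorphAt 𝓘(ℝ, Space) J1Model ∞ Φ p :=
    hΘ.comp (K := J1Model) (P := J1) (J1.isLocalDiffeomorphAt_ofCoords _)
  obtain ⟨g, hg, hgp, hgΦ, hΦg⟩ := hΦ.exists_inverse
  -- The pushforward of `E₂` by `Φ`, written with a local inverse; only its values near `Φ p`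
  -- matter.
  let E : J1Family := fun y =>
    (show Submodule ℝ (Plane × ℝ) from
      (E₂ (g y)).map (mfderiv 𝓘(ℝ, Space) J1Model Φ (g y)).toLinearMap)
  refine ⟨E, Φ p, Φ, hΦ, rfl, ?_⟩
  filter_upwards [hψ, h₁, h₂, hgΦ, hΦ.eventually] with r hr hr₁ hr₂ hgr hΦr
  have hd : MDifferentiableAt 𝓘(ℝ, Space) J1Model Φ r := hΦr.mdifferentiableAt (by simp)
  have hinj := hΦr.mfderiv_injective
  have hfst : ∀ ξ : Space, (show Plane × ℝ from mfderiv 𝓘(ℝ, Space) J1Model Φ r ξ).1 =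
      fderiv ℝ ψ r ξ := by
    intro ξ
    refine (J1.mfderiv_apply_fst hd ξ).trans ?_
    change mfderiv 𝓘(ℝ, Space) 𝓘(ℝ, Plane) ψ r ξ = _
    rw [mfderiv_eq_fderiv]
    rfl
  have hE₁ : (E₁ r).map (mfderiv 𝓘(ℝ, Space) J1Model Φ r).toLinearMap = verticalField (Φ r) := by
    refine (Submodule.map_eq_span_singleton hr₁.2.2 _).trans ?_
    refine verticalField_eq_span ((hfst _).trans hr.1) ?_
    intro h0
    exact hr₁.2.1 (hinj (h0.trans (map_zero _).symm))
  refine ⟨?_, hE₁, ?_⟩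
  · rw [Submodule.map_sup, hE₁]
    refine (congrArg _ (Submodule.map_eq_span_singleton hr₂.2.2 _)).trans ?_
    refine contactDistribution_eq_span ?_ ?_
    · exact ne_of_eq_of_ne (hfst _) hr.2.1
    · refine (hfst (X₂ r)).symm ▸ ?_
      obtain ⟨c, hc⟩ := hr.2.2
      rw [hc]
      change c • ((1, z r) : Plane) ∈ (ofSlope (z r)).submodule
      rw [ofSlope, Projectivization.submodule_mk]
      exact Submodule.smul_mem _ _ (Submodule.mem_span_singleton_self _)
  · change _ = (show Submodule ℝ (Plane × ℝ) from
      (E₂ (g (Φ r))).map (mfderiv 𝓘(ℝ, Space) J1Model Φ (g (Φ r))).toLinearMap)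
    rw [hgr]
    rfl

/-! ## Prolongations -/

theorem IsLocalDiffeomorphAt.fderiv_injective {φ : Plane → Plane} {p : Plane}
    (hφ : IsLocalDiffeomorphAt 𝓘(ℝ, Plane) 𝓘(ℝ, Plane) ∞ φ p) :
    Function.Injective (fderiv ℝ φ p).toLinearMap := by
  have h := hφ.mfderiv_injective
  rw [mfderiv_eq_fderiv] at h
  exact h

namespace PlaneDirection

theorem exists_ofVector (l : PlaneDirection) : ∃ v : Plane, v ≠ 0 ∧ ofVector v = l :=
  ⟨l.rep, l.rep_nonzero, by rw [ofVector_of_ne l.rep_nonzero, l.mk_rep]⟩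

theorem eq_ofVector_of_mem {l : PlaneDirection} {v : Plane} (hv : v ≠ 0) (h : v ∈ l.submodule) :
    l = ofVector v := by
  obtain ⟨w, hw, rfl⟩ := exists_ofVector l
  rw [submodule_ofVector hw] at h
  obtain ⟨c, rfl⟩ := Submodule.mem_span_singleton.1 h
  have hc : c ≠ 0 := by
    rintro rfl
    simp at hv
  rw [ofVector_smul hw hc]

end PlaneDirection

theorem prolongation_ofVector {φ : Plane → Plane} {p : Plane}
    (h : Function.Injective (fderiv ℝ φ p).toLinearMap) {v : Plane} (hv : v ≠ 0) :
    prolongation φ (p, ofVector v) = (φ p, ofVector (fderiv ℝ φ p v)) := by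
  have hv' : fderiv ℝ φ p v ≠ 0 := fun h0 => hv (h (h0.trans (map_zero _).symm))
  rw [ofVector_of_ne hv, ofVector_of_ne hv']
  refine Prod.ext rfl ?_
  simp only [prolongation]
  rw [dif_pos h]
  exact Projectivization.map_mk _ h v hv

theorem prolongation_prolongation {φ ψ : Plane → Plane} {q : J1}
    (hφ : IsLocalDiffeomorphAt 𝓘(ℝ, Plane) 𝓘(ℝ, Plane) ∞ φ q.1)
    (hψ : IsLocalDiffeomorphAt 𝓘(ℝ, Plane) 𝓘(ℝ, Plane) ∞ ψ (φ q.1))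
    (h : ∀ᶠ p in 𝓝 q.1, ψ (φ p) = p) : prolongation ψ (prolongation φ q) = q := by
  obtain ⟨p, l⟩ := q
  obtain ⟨v, hv, rfl⟩ := exists_ofVector l
  have hφi := hφ.fderiv_injective
  have hv' : fderiv ℝ φ p v ≠ 0 := fun h0 => hv (hφi (h0.trans (map_zero _).symm))
  rw [prolongation_ofVector hφi hv, prolongation_ofVector hψ.fderiv_injective hv']
  have hφd : DifferentiableAt ℝ φ p :=
    (contMDiffAt_iff_contDiffAt.1 hφ.contMDiffAt).differentiableAt (by simp)
  have hψd : DifferentiableAt ℝ ψ (φ p) :=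
    (contMDiffAt_iff_contDiffAt.1 hψ.contMDiffAt).differentiableAt (by simp)
  have hd := (hψd.hasFDerivAt.comp p hφd.hasFDerivAt).unique
    ((hasFDerivAt_id p).congr_of_eventuallyEq h)
  have hd' : fderiv ℝ ψ (φ p) (fderiv ℝ φ p v) = v := DFunLike.congr_fun hd v
  rw [hd', show ψ (φ p) = p from h.self_of_nhds]

/-- A smooth local choice of representing vectors turns the prolongation into `dφ` applied to a
smooth nonzero vector, followed by passage to its direction. -/
theorem contMDiffAt_prolongation {φ : Plane → Plane} {q : J1}
    (hφ : IsLocalDiffeomorphAt 𝓘(ℝ, Plane) 𝓘(ℝ, Plane) ∞ φ q.1) :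
    ContMDiffAt J1Model J1Model ∞ (prolongation φ) q := by
  obtain ⟨s, hs⟩ := exists_section q.2
  have hs' := hs.self_of_nhds
  have hφ' := contMDiffAt_iff_contDiffAt.1 hφ.contMDiffAt
  have h0 : fderiv ℝ φ q.1 (s q.2) ≠ 0 := fun h0 =>
    hs'.2.1 (hφ.fderiv_injective (h0.trans (map_zero _).symm))
  have h1 : ContMDiffAt J1Model 𝓘(ℝ, Plane →L[ℝ] Plane) ∞ (fun r : J1 => fderiv ℝ φ r.1) q :=
    ContMDiffAt.comp (I' := 𝓘(ℝ, Plane)) q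
      (hφ'.fderiv_right (m := ∞) (by simp)).contMDiffAt contMDiffAt_fst
  have h2 : ContMDiffAt J1Model 𝓘(ℝ, Plane) ∞ (fun r : J1 => s r.2) q :=
    hs'.1.comp q contMDiffAt_snd
  have h3 : ContMDiffAt J1Model J1Model ∞
      (fun r : J1 => (φ r.1, ofVector (fderiv ℝ φ r.1 (s r.2)))) q :=
    (hφ.contMDiffAt.comp q contMDiffAt_fst).prodMk
      (ContMDiffAt.comp (I' := 𝓘(ℝ, Plane)) q (contMDiffAt_ofVector h0) (h1.clm_apply h2))
  refine h3.congr_of_eventuallyEq ?_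
  filter_upwards [continuous_snd.continuousAt.eventually hs,
    continuous_fst.continuousAt.eventually hφ.eventually] with r hr hr'
  have h4 := prolongation_ofVector hr'.fderiv_injective hr.2.1
  rw [hr.2.2] at h4
  exact h4

theorem isLocalDiffeomorphAt_prolongation {φ : Plane → Plane} {q : J1}
    (hφ : IsLocalDiffeomorphAt 𝓘(ℝ, Plane) 𝓘(ℝ, Plane) ∞ φ q.1) :
    IsLocalDiffeomorphAt J1Model J1Model ∞ (prolongation φ) q := by
  obtain ⟨ψ, hψ, hψq, hψφ, hφψ⟩ := hφ.exists_inverse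
  have hφt : Filter.Tendsto φ (𝓝 q.1) (𝓝 (φ q.1)) := hφ.contMDiffAt.continuousAt
  have hψt : Filter.Tendsto ψ (𝓝 (φ q.1)) (𝓝 q.1) := by
    have := hψ.contMDiffAt.continuousAt
    rwa [ContinuousAt, hψq] at this
  have hfst : Filter.Tendsto (Prod.fst : J1 → Plane) (𝓝 q) (𝓝 q.1) := continuous_fst.tendsto q
  have hfst' : Filter.Tendsto (Prod.fst : J1 → Plane) (𝓝 (prolongation φ q)) (𝓝 (φ q.1)) :=
    continuous_fst.tendsto (prolongation φ q)
  refine isLocalDiffeomorphAt_of_inverse (g := prolongation ψ) ?_ ?_ ?_ ?_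
  · exact (hfst.eventually hφ.eventually).mono fun r hr => contMDiffAt_prolongation hr
  · exact (hfst'.eventually hψ.eventually).mono fun r hr => contMDiffAt_prolongation hr
  · filter_upwards [hfst.eventually hφ.eventually, hfst.eventually (hφt.eventually hψ.eventually),
      hfst.eventually hψφ.eventually_nhds] with r h1 h2 h3
    exact prolongation_prolongation h1 h2 h3
  · filter_upwards [hfst'.eventually hψ.eventually,
      hfst'.eventually (hψt.eventually hφ.eventually), hfst'.eventually hφψ.eventually_nhds]
      with r h1 h2 h3
    exact prolongation_prolongation h1 h2 h3

theorem mfderiv_comp_fst_apply {φ : Plane → Plane} {q : J1} (hφ : DifferentiableAt ℝ φ q.1)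
    (ξ : Plane × ℝ) :
    mfderiv J1Model 𝓘(ℝ, Plane) (fun r : J1 => φ r.1) q ξ = fderiv ℝ φ q.1 ξ.1 := by
  have h : mfderiv J1Model 𝓘(ℝ, Plane) (φ ∘ J1.proj) q =
      (mfderiv 𝓘(ℝ, Plane) 𝓘(ℝ, Plane) φ q.1).comp (mfderiv J1Model 𝓘(ℝ, Plane) J1.proj q) :=
    mfderiv_comp q hφ.mdifferentiableAt mdifferentiableAt_fst
  change mfderiv J1Model 𝓘(ℝ, Plane) (φ ∘ J1.proj) q ξ = _
  rw [h, mfderiv_eq_fderiv]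
  exact congrArg _ (J1.mfderiv_proj_apply q ξ)

/-- The prolongation covers `φ`, so vertical vectors have vertical images; these are nonzero because
the differential is injective. -/
theorem carries_prolongation_verticalField {φ : Plane → Plane} {q : J1}
    (hφ : IsLocalDiffeomorphAt 𝓘(ℝ, Plane) 𝓘(ℝ, Plane) ∞ φ q.1) :
    Carries (prolongation φ) verticalField verticalField q := by
  have hfst : Filter.Tendsto (Prod.fst : J1 → Plane) (𝓝 q) (𝓝 q.1) := continuous_fst.tendsto q
  filter_upwards [hfst.eventually hφ.eventually] with r hr
  have hΦ := isLocalDiffeomorphAt_prolongation hr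
  have hφd : DifferentiableAt ℝ φ r.1 :=
    (contMDiffAt_iff_contDiffAt.1 hr.contMDiffAt).differentiableAt (by simp)
  have hV : verticalField r = Submodule.span ℝ {(show TangentSpace J1Model r from
      ((0, 1) : Plane × ℝ))} := (verticalField_eq_span rfl (by simp)).symm
  refine (Submodule.map_eq_span_singleton hV _).trans (verticalField_eq_span ?_ ?_)
  · refine (J1.mfderiv_apply_fst (hΦ.mdifferentiableAt (by simp)) _).trans ?_
    refine (mfderiv_comp_fst_apply hφd ((0, 1) : Plane × ℝ)).trans ?_
    exact map_zero _
  · intro h0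
    have h1 := hΦ.mfderiv_injective (h0.trans (map_zero _).symm)
    have h2 : ((0, 1) : Plane × ℝ) = 0 := h1
    simp at h2

/-- A local diffeomorphism of the space of jets which preserves the vertical field takes fibres
of the projection to the plane to fibres. -/
theorem Carries.eventually_fst_eq {Ψ : J1 → J1} {q : J1}
    (hΨ : IsLocalDiffeomorphAt J1Model J1Model ∞ Ψ q)
    (hV : Carries Ψ verticalField verticalField q) :
    ∀ᶠ r in 𝓝 q, (Ψ r).1 = (Ψ (r.1, q.2)).1 := by
  -- In a chart, the part of each fibre near `q` becomes an interval, and one radius `ε` serves all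
  -- nearby base points.
  let e := chartAt ℝ q.2
  let c : Plane × ℝ → J1 := fun u => (u.1, e.symm u.2)
  have hq2 : q.2 ∈ e.source := mem_chart_source ℝ q.2
  have hcq : c (q.1, e q.2) = q := Prod.ext rfl (e.left_inv hq2)
  have hc : Filter.Tendsto c (𝓝 (q.1, e q.2)) (𝓝 q) := by
    have h1 : ContinuousAt c (q.1, e q.2) :=
      continuousAt_fst.prodMk
        ((e.continuousAt_symm (e.map_source hq2)).comp (x := (q.1, e q.2)) continuousAt_snd)
    rwa [ContinuousAt, hcq] at h1
  have hgood : ∀ᶠ u in 𝓝 (q.1, e q.2), u.2 ∈ e.target ∧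
      (IsLocalDiffeomorphAt J1Model J1Model ∞ Ψ (c u) ∧
        (verticalField (c u)).map (mfderiv J1Model J1Model Ψ (c u)).toLinearMap =
          verticalField (Ψ (c u))) := by
    refine Filter.Eventually.and ?_ (hc.eventually (hΨ.eventually.and hV))
    exact continuousAt_snd.eventually (e.open_target.mem_nhds (e.map_source hq2))
  obtain ⟨ε, hε, hball⟩ := Metric.eventually_nhds_iff_ball.1 hgood
  -- A curve in a fibre has vertical velocity, which `Ψ` keeps vertical, so the plane component of
  -- the image has zero derivative.
  have hder : ∀ p ∈ Metric.ball q.1 ε, ∀ z ∈ Metric.ball (e q.2) ε,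
      HasFDerivAt (fun z => (Ψ (p, e.symm z)).1) (0 : ℝ →L[ℝ] Plane) z := by
    intro p hp z hz
    have hpz : (p, z) ∈ Metric.ball (q.1, e q.2) ε := by
      rw [← ball_prod_same]
      exact ⟨hp, hz⟩
    obtain ⟨hzt, hΨz, hVz⟩ := hball _ hpz
    have hed : MDifferentiableAt 𝓘(ℝ, ℝ) 𝓘(ℝ, ℝ) e.symm z :=
      ((contMDiffOn_chart_symm (n := ∞)).contMDiffAt
        (e.open_target.mem_nhds hzt)).mdifferentiableAt (by simp)
    have hcd : MDifferentiableAt 𝓘(ℝ, ℝ) J1Model (fun z => c (p, z)) z :=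
      mdifferentiableAt_const.prodMk hed
    have hΨd : MDifferentiableAt J1Model J1Model Ψ (c (p, z)) :=
      hΨz.mdifferentiableAt (by simp)
    have hΨc : MDifferentiableAt 𝓘(ℝ, ℝ) J1Model (Ψ ∘ fun z => c (p, z)) z :=
      MDifferentiableAt.comp z hΨd hcd
    have hG : MDifferentiableAt 𝓘(ℝ, ℝ) 𝓘(ℝ, Plane) (fun z => (Ψ (p, e.symm z)).1) z :=
      MDifferentiableAt.comp (I' := J1Model) z mdifferentiableAt_fst hΨc
    have hG' := hG.differentiableAt.hasFDerivAt
    have hzero : fderiv ℝ (fun z => (Ψ (p, e.symm z)).1) z = 0 := by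
      apply ContinuousLinearMap.ext
      intro t
      have h1 := J1.mfderiv_apply_fst hΨc t
      have h2 : mfderiv 𝓘(ℝ, ℝ) 𝓘(ℝ, Plane) (fun z => (Ψ (p, e.symm z)).1) z t =
          fderiv ℝ (fun z => (Ψ (p, e.symm z)).1) z t := by
        rw [mfderiv_eq_fderiv]
        rfl
      refine h2.symm.trans (h1.symm.trans ?_)
      rw [mfderiv_comp z hΨd hcd]
      have h3 : mfderiv 𝓘(ℝ, ℝ) J1Model (fun z => c (p, z)) z t ∈ verticalField (c (p, z)) := by
        refine mem_verticalField.2 ((J1.mfderiv_apply_fst hcd t).trans ?_)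
        change mfderiv 𝓘(ℝ, ℝ) 𝓘(ℝ, Plane) (fun _ => p) z t = 0
        rw [mfderiv_const]
        rfl
      have h4 := Submodule.mem_map_of_mem
        (f := (mfderiv J1Model J1Model Ψ (c (p, z))).toLinearMap) h3
      rw [hVz] at h4
      exact mem_verticalField.1 h4
    rwa [hzero] at hG'
  have hsnd : ContinuousAt (fun r : J1 => e r.2) q :=
    (e.continuousAt hq2).comp (x := q) continuousAt_snd
  filter_upwards [continuousAt_fst.eventually (Metric.ball_mem_nhds q.1 hε),
    continuousAt_snd.eventually (e.open_source.mem_nhds hq2),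
    hsnd.eventually (Metric.ball_mem_nhds (e q.2) hε)] with r h1 h2 h3
  have hconst := (convex_ball (e q.2) ε).is_const_of_fderivWithin_eq_zero (𝕜 := ℝ)
    (fun z hz => (hder r.1 h1 z hz).differentiableAt.differentiableWithinAt)
    (fun z hz => by
      rw [fderivWithin_of_isOpen Metric.isOpen_ball hz]
      exact (hder r.1 h1 z hz).fderiv) h3 (Metric.mem_ball_self hε)
  rwa [e.left_inv h2, e.left_inv hq2] at hconst

theorem eventually_contMDiffAt_fst_section {Ψ : J1 → J1} {q : J1}
    (hΨ : IsLocalDiffeomorphAt J1Model J1Model ∞ Ψ q) :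
    ∀ᶠ p in 𝓝 q.1, ContMDiffAt 𝓘(ℝ, Plane) 𝓘(ℝ, Plane) ∞ (fun p => (Ψ (p, q.2)).1) p := by
  have hc : Filter.Tendsto (fun p : Plane => ((p, q.2) : J1)) (𝓝 q.1) (𝓝 q) :=
    (Continuous.prodMk_left q.2).tendsto q.1
  filter_upwards [hc.eventually hΨ.eventually] with p hp
  exact contMDiffAt_fst.comp p (hp.contMDiffAt.comp p (contMDiffAt_id.prodMk contMDiffAt_const))

/-- A local diffeomorphism of the space of jets which preserves the vertical field and the contact
distribution is the prolongation of a local diffeomorphism of the plane. -/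
theorem exists_eq_prolongation {Ψ : J1 → J1} {q : J1}
    (hΨ : IsLocalDiffeomorphAt J1Model J1Model ∞ Ψ q)
    (hV : Carries Ψ verticalField verticalField q)
    (hC : Carries Ψ contactDistribution contactDistribution q) :
    ∃ φ : Plane → Plane, IsLocalDiffeomorphAt 𝓘(ℝ, Plane) 𝓘(ℝ, Plane) ∞ φ q.1 ∧
      Ψ =ᶠ[𝓝 q] prolongation φ := by
  obtain ⟨Θ, hΘ, hΘq, hΘΨ, hΨΘ⟩ := hΨ.exists_inverse
  have hV' := hV.inverse hΨ hΘ hΘq hΘΨ hΨΘ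
  have h1 := Carries.eventually_fst_eq hΨ hV
  have h2 := Carries.eventually_fst_eq hΘ hV'
  -- By `h1` the base point of `Ψ (p, l)` near `q` does not depend on `l`, so it may be read off
  -- with the direction frozen at `q.2`. The same is done for the inverse `Θ`.
  let φ : Plane → Plane := fun p => (Ψ (p, q.2)).1
  let ψ : Plane → Plane := fun p => (Θ (p, (Ψ q).2)).1
  have hc : Filter.Tendsto (fun p : Plane => ((p, q.2) : J1)) (𝓝 q.1) (𝓝 q) :=
    (Continuous.prodMk_left q.2).tendsto q.1
  have hc' : Filter.Tendsto (fun p : Plane => ((p, (Ψ q).2) : J1)) (𝓝 (Ψ q).1) (𝓝 (Ψ q)) :=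
    (Continuous.prodMk_left (Ψ q).2).tendsto (Ψ q).1
  have hΨt : Filter.Tendsto Ψ (𝓝 q) (𝓝 (Ψ q)) := hΨ.contMDiffAt.continuousAt
  have hΘt : Filter.Tendsto Θ (𝓝 (Ψ q)) (𝓝 q) := by
    have := hΘ.contMDiffAt.continuousAt
    rwa [ContinuousAt, hΘq] at this
  have hφ : IsLocalDiffeomorphAt 𝓘(ℝ, Plane) 𝓘(ℝ, Plane) ∞ φ q.1 := by
    refine isLocalDiffeomorphAt_of_inverse (g := ψ) (eventually_contMDiffAt_fst_section hΨ)
      (eventually_contMDiffAt_fst_section hΘ) ?_ ?_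
    -- `ψ` freezes the direction at `(Ψ q).2`, whereas `Θ` undoes `Ψ` at the actual image point;
    -- `h2` says that both give the same base point.
    · filter_upwards [hc.eventually hΘΨ, hc.eventually (hΨt.eventually h2)] with p hp hp'
      rw [hp] at hp'
      exact hp'.symm
    · filter_upwards [hc'.eventually hΨΘ, hc'.eventually (hΘt.eventually h1)] with p hp hp'
      rw [hp] at hp'
      exact hp'.symm
  refine ⟨φ, hφ, ?_⟩
  have hfst : Filter.Tendsto (Prod.fst : J1 → Plane) (𝓝 q) (𝓝 q.1) := continuous_fst.tendsto q
  filter_upwards [h1.eventually_nhds, hfst.eventually hφ.eventually, hC,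
    hΨ.eventually_mdifferentiableAt] with r hr hφr hCr hΨr
  obtain ⟨p, l⟩ := r
  obtain ⟨v, hv, rfl⟩ := exists_ofVector l
  have hφi := hφr.fderiv_injective
  have hφd : DifferentiableAt ℝ φ p :=
    (contMDiffAt_iff_contDiffAt.1 hφr.contMDiffAt).differentiableAt (by simp)
  have hv' : fderiv ℝ φ p v ≠ 0 := fun h0 => hv (hφi (h0.trans (map_zero _).symm))
  rw [prolongation_ofVector hφi hv]
  refine Prod.ext hr.self_of_nhds ?_
  refine eq_ofVector_of_mem hv' ?_
  -- The test vector `(v, 0)` is a contact vector. Its image is contact too and projects to `dφ v`,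
  -- so the direction of `Ψ (p, ofVector v)` contains `dφ v`.
  have hξ : (show TangentSpace J1Model ((p, ofVector v) : J1) from ((v, 0) : Plane × ℝ)) ∈
      contactDistribution ((p, ofVector v) : J1) := by
    refine mem_contactDistribution.2 ?_
    rw [submodule_ofVector hv]
    exact Submodule.mem_span_singleton_self v
  have hη := Submodule.mem_map_of_mem
    (f := (mfderiv J1Model J1Model Ψ ((p, ofVector v) : J1)).toLinearMap) hξ
  rw [hCr] at hη
  have hη1 := mem_contactDistribution.1 hη
  have hd : mfderiv J1Model 𝓘(ℝ, Plane) (fun r => (Ψ r).1) ((p, ofVector v) : J1) =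
      mfderiv J1Model 𝓘(ℝ, Plane) (fun r : J1 => φ r.1) ((p, ofVector v) : J1) :=
    Filter.EventuallyEq.mfderiv_eq hr
  have h3 := J1.mfderiv_apply_fst hΨr ((v, 0) : Plane × ℝ)
  rw [hd] at h3
  have h4 := h3.trans (mfderiv_comp_fst_apply (q := (p, ofVector v)) hφd ((v, 0) : Plane × ℝ))
  rw [← h4]
  exact hη1

/-! ## Correspondence of pairs and equations -/

/-- A minor of the coordinates of the two generators equals `1` at `p`, stays nonzero nearby, and
would vanish if the generators were proportional. -/
theorem IsNondegeneratePairAt.eventually_ne {E₁ E₂ : SpaceFamily} {p : Space}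
    (h : IsNondegeneratePairAt E₁ E₂ p) : ∀ᶠ r in 𝓝 p, E₁ r ≠ E₂ r := by
  obtain ⟨X₁, X₂, A, h₁, h₂, hA₁, hA₂, -⟩ := h.exists_generators
  have hX₁ : ContinuousAt (fun r => A (X₁ r)) p :=
    A.continuous.continuousAt.comp h₁.eventually_contDiffAt.self_of_nhds.continuousAt
  have hX₂ : ContinuousAt (fun r => A (X₂ r)) p :=
    A.continuous.continuousAt.comp h₂.eventually_contDiffAt.self_of_nhds.continuousAt
  have hdet : ContinuousAt
      (fun r => (A (X₁ r)).1 * (A (X₂ r)).2.1 - (A (X₁ r)).2.1 * (A (X₂ r)).1) p :=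
    (hX₁.fst.mul hX₂.snd.fst).sub (hX₁.snd.fst.mul hX₂.fst)
  filter_upwards [h₁, h₂, hdet.eventually_ne (y := 0) (by simp [hA₁, hA₂])] with r hr₁ hr₂ hr hE
  have hmem : X₂ r ∈ Submodule.span ℝ {(X₁ r : Space)} := by
    have h3 : (show TangentSpace 𝓘(ℝ, Space) r from X₂ r) ∈ E₂ r := by
      rw [hr₂.2.2]
      exact Submodule.mem_span_singleton_self _
    rw [← hE, hr₁.2.2] at h3
    exact h3
  obtain ⟨c, hc⟩ := Submodule.mem_span_singleton.1 hmem
  apply hr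
  simp only [← hc, map_smul, Prod.smul_fst, Prod.smul_snd, smul_eq_mul]
  ring

section Generators

variable {V H W H' : Type*} [NormedAddCommGroup V] [NormedSpace ℝ V] [TopologicalSpace H]
  [NormedAddCommGroup W] [NormedSpace ℝ W] [TopologicalSpace H'] [CompleteSpace V]
  {I : ModelWithCorners ℝ V H} {J : ModelWithCorners ℝ W H'} {M N : Type*} [TopologicalSpace M]
  [ChartedSpace H M] [TopologicalSpace N] [ChartedSpace H' N] [IsManifold I ∞ M]
  [IsManifold J ∞ N]

/-- The preimage of a direction field under a local diffeomorphism is a direction field. -/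
theorem Carries.isDirectionFieldAt {E : TangentFamily I M} {E' : TangentFamily J N} {f : M → N}
    {x : M} (hE : Carries f E E' x) (hf : IsLocalDiffeomorphAt I J ∞ f x)
    {X : ∀ y : N, TangentSpace J y} (hX : GeneratesAt J X E' (f x)) : IsDirectionFieldAt I E x := by
  refine ⟨VectorField.mpullback I J f X, ?_⟩
  filter_upwards [hE, hf.eventually, hf.contMDiffAt.continuousAt.eventually hX] with r h1 h2 h3
  let L := h2.mfderivToContinuousLinearEquiv (by simp)
  have hL : (L : TangentSpace I r →L[ℝ] TangentSpace J (f r)) = mfderiv I J f r := rfl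
  have hinv : (mfderiv I J f r).IsInvertible := ⟨L, hL⟩
  have happ : VectorField.mpullback I J f X r = L.symm (X (f r)) := by
    rw [VectorField.mpullback_apply, ← hL, ContinuousLinearMap.inverse_equiv]
    rfl
  refine ⟨h3.1.mpullback_vectorField_preimage h2.contMDiffAt hinv (by simp), ?_, ?_⟩
  · rw [happ]
    exact fun h0 => h3.2.1 (L.symm.injective (h0.trans (map_zero _).symm))
  · rw [happ]
    have h4 : (E r).map L.toLinearEquiv.toLinearMap = Submodule.span ℝ {X (f r)} :=
      h1.trans h3.2.2
    have h5 := congrArg (Submodule.map L.toLinearEquiv.symm.toLinearMap) h4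
    rw [← Submodule.map_comp, LinearEquiv.comp_coe, LinearEquiv.self_trans_symm] at h5
    refine ((Submodule.map_id _).symm.trans h5).trans ?_
    exact Submodule.map_eq_span_singleton rfl _

end Generators

/-- A field which corresponds to a nondegenerate pair is a second-order equation. -/
theorem CorrespondsAt.isSecondOrderEquationAt {E₁ E₂ : SpaceFamily} {p : Space} {E : J1Family}
    {q : J1} (hE : CorrespondsAt E₁ E₂ p E q) (h : IsNondegeneratePairAt E₁ E₂ p) :
    IsSecondOrderEquationAt E q := by
  obtain ⟨Φ, hΦ, rfl, hc⟩ := hE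
  obtain ⟨g, hg, hgp, hgΦ, hΦg⟩ := hΦ.exists_inverse
  have hE₂ : Carries Φ E₂ E p := hc.mono fun r hr => hr.2.2
  obtain ⟨X₁, X₂, A, -, hX₂, -⟩ := h.exists_generators
  refine ⟨(hE₂.inverse hΦ hg hgp hgΦ hΦg).isDirectionFieldAt hg (X := X₂)
    (by rw [hgp]; exact hX₂), ?_⟩
  have hgt : Filter.Tendsto g (𝓝 (Φ p)) (𝓝 p) := by
    have := hg.contMDiffAt.continuousAt
    rwa [ContinuousAt, hgp] at this
  have hP : ∀ᶠ r in 𝓝 p, E (Φ r) ≤ contactDistribution (Φ r) ∧ E (Φ r) ≠ verticalField (Φ r) := by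
    filter_upwards [hc, h.eventually_ne, hΦ.eventually] with r hr hne hΦr
    refine ⟨?_, ?_⟩
    · rw [← hr.1, ← hr.2.2]
      exact Submodule.map_mono le_sup_right
    · rw [← hr.2.1, ← hr.2.2]
      exact fun heq => hne (Submodule.map_injective_of_injective
        (f := (mfderiv 𝓘(ℝ, Space) J1Model Φ r).toLinearMap) hΦr.mfderiv_injective heq).symm
  filter_upwards [hgt.eventually hP, hΦg] with y hy hy'
  rwa [hy'] at hy

/-- The map `Φ' ∘ f ∘ Φ⁻¹` preserves the vertical field, the image of `E₁`, and the contact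
distribution, the image of `E₁ ⊕ E₂`. It is therefore a prolongation, and it carries `E` to `E'`. -/
theorem PairsLocallyEquivalent.equationsLocallyEquivalent {E₁ E₂ E₁' E₂' : SpaceFamily}
    {p p' : Space} {E E' : J1Family} {q q' : J1} (hE : CorrespondsAt E₁ E₂ p E q)
    (hE' : CorrespondsAt E₁' E₂' p' E' q')
    (h : PairsLocallyEquivalent E₁ E₂ p E₁' E₂' p') : EquationsLocallyEquivalent E q E' q' := by
  obtain ⟨Φ, hΦ, rfl, hc⟩ := hE
  obtain ⟨Φ', hΦ', rfl, hc'⟩ := hE'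
  obtain ⟨f, hf, rfl, hfE⟩ := h
  obtain ⟨g, hg, hgp, hgΦ, hΦg⟩ := hΦ.exists_inverse
  have hf₁ : Carries f E₁ E₁' p := hfE.mono fun r hr => hr.1
  have hf₂ : Carries f E₂ E₂' p := hfE.mono fun r hr => hr.2
  have transport : ∀ {F : SpaceFamily} {F' : SpaceFamily} {G G' : J1Family},
      Carries Φ F G p → Carries f F F' p → Carries Φ' F' G' (f p) →
        Carries (Φ' ∘ f ∘ g) G G' (Φ p) := by
    intro F F' G G' h1 h2 h3
    have h4 := h1.inverse hΦ hg hgp hgΦ hΦg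
    have h5 : Carries (f ∘ g) G F' (Φ p) :=
      h4.comp (by rw [hgp]; exact h2) hg (by rw [hgp]; exact hf)
    exact h5.comp (by rw [Function.comp_apply, hgp]; exact h3)
      (hg.comp (K := 𝓘(ℝ, Space)) (P := Space) (by rw [hgp]; exact hf))
      (by rw [Function.comp_apply, hgp]; exact hΦ')
  have hΨ : IsLocalDiffeomorphAt J1Model J1Model ∞ (Φ' ∘ f ∘ g) (Φ p) :=
    (hg.comp (K := 𝓘(ℝ, Space)) (P := Space) (by rw [hgp]; exact hf)).comp (K := J1Model) (P := J1)
      (by rw [Function.comp_apply, hgp]; exact hΦ')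
  obtain ⟨φ, hφ, hφΨ⟩ := exists_eq_prolongation hΨ
    (transport (hc.mono fun r hr => hr.2.1) hf₁ (hc'.mono fun r hr => hr.2.1))
    (transport (F := fun r => E₁ r ⊔ E₂ r) (F' := fun r => E₁' r ⊔ E₂' r)
      (hc.mono fun r hr => hr.1) (hf₁.sup hf₂) (hc'.mono fun r hr => hr.1))
  refine ⟨φ, hφ, ?_, ?_⟩
  · rw [← hφΨ.self_of_nhds, Function.comp_apply, Function.comp_apply, hgp]
  · exact (transport (hc.mono fun r hr => hr.2.2) hf₂ (hc'.mono fun r hr => hr.2.2)).congr hφΨ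

/-- The equivalence is `Φ'⁻¹ ∘ prolongation φ ∘ Φ`. It matches `E₁` with `E₁'` because prolongations
preserve the vertical field, and `E₂` with `E₂'` because this one takes `E` to `E'`. -/
theorem EquationsLocallyEquivalent.pairsLocallyEquivalent {E₁ E₂ E₁' E₂' : SpaceFamily}
    {p p' : Space} {E E' : J1Family} {q q' : J1} (hE : CorrespondsAt E₁ E₂ p E q)
    (hE' : CorrespondsAt E₁' E₂' p' E' q')
    (h : EquationsLocallyEquivalent E q E' q') : PairsLocallyEquivalent E₁ E₂ p E₁' E₂' p' := by
  obtain ⟨Φ, hΦ, rfl, hc⟩ := hE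
  obtain ⟨Φ', hΦ', rfl, hc'⟩ := hE'
  obtain ⟨φ, hφ, hφq, hφE⟩ := h
  obtain ⟨g, hg, hgp, hgΦ, hΦg⟩ := hΦ'.exists_inverse
  have hΨ := isLocalDiffeomorphAt_prolongation hφ
  have hΨΦ : IsLocalDiffeomorphAt 𝓘(ℝ, Space) J1Model ∞ (prolongation φ ∘ Φ) p :=
    hΦ.comp (K := J1Model) (P := J1) hΨ
  have transport : ∀ {F F' : SpaceFamily} {G G' : J1Family},
      Carries Φ F G p → Carries (prolongation φ) G G' (Φ p) → Carries Φ' F' G' p' →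
        Carries (g ∘ prolongation φ ∘ Φ) F F' p := by
    intro F F' G G' h1 h2 h3
    have h4 := h3.inverse hΦ' hg hgp hgΦ hΦg
    exact (h1.comp h2 hΦ hΨ).comp (by rw [Function.comp_apply, hφq]; exact h4) hΨΦ
      (by rw [Function.comp_apply, hφq]; exact hg)
  refine ⟨g ∘ prolongation φ ∘ Φ, ?_, ?_, ?_⟩
  · exact hΨΦ.comp (K := 𝓘(ℝ, Space)) (P := Space)
      (by rw [Function.comp_apply, hφq]; exact hg)
  · rw [Function.comp_apply, Function.comp_apply, hφq, hgp]
  · exact (transport (hc.mono fun r hr => hr.2.1) (carries_prolongation_verticalField hφ)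
      (hc'.mono fun r hr => hr.2.1)).and
      (transport (hc.mono fun r hr => hr.2.2) hφE (hc'.mono fun r hr => hr.2.2))

theorem theorem2 (E₁ E₂ E₁' E₂' : SpaceFamily) (p p' : Space)
    (h : IsNondegeneratePairAt E₁ E₂ p) (h' : IsNondegeneratePairAt E₁' E₂' p') :
    (∃ (E : J1Family) (q : J1), CorrespondsAt E₁ E₂ p E q) ∧
    (∃ (E' : J1Family) (q' : J1), CorrespondsAt E₁' E₂' p' E' q') ∧
    ∀ (E E' : J1Family) (q q' : J1),
      CorrespondsAt E₁ E₂ p E q → CorrespondsAt E₁' E₂' p' E' q' →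
        IsSecondOrderEquationAt E q ∧ IsSecondOrderEquationAt E' q' ∧
        (PairsLocallyEquivalent E₁ E₂ p E₁' E₂' p' ↔ EquationsLocallyEquivalent E q E' q') :=
  ⟨h.exists_correspondsAt, h'.exists_correspondsAt, fun _ _ _ _ hE hE' =>
    ⟨hE.isSecondOrderEquationAt h, hE'.isSecondOrderEquationAt h',
      fun he => he.equationsLocallyEquivalent hE hE',
      fun he => he.pairsLocallyEquivalent hE hE'⟩⟩
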